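/- **Conventions.** Let $S$ be the set of finite binary strings, $\Omega=\{0,1\}^{\mathbb N}$, and order $S\cup\Omega$ by the prefix relation $\sqsubseteq$ and $(S\cup\Omega)^2$ componentwise; $\lambda$ is the empty string, $\boldsymbol\lambda=(\lambda,\lambda)$, $|x|$ is the length of $x$ ($\infty$ for $x\in\Omega$), $\log$ has base $2$, and $\bigvee$ denotes the least upper bound. For $\mathbf x\in S^2$ let $\Delta(\mathbf x)=\{\mathbf w\in\Omega^2:\mathbf x\sqsubseteq\mathbf w\}$, and $P(\mathbf x)=P(\Delta(\mathbf x))$ for a probability $P$ on $\Omega^2$ with its product $\sigma$-algebra; for $A\subset S^2$ let $\tilde A=\bigcup_{\mathbf x\in A}\Delta(\mathbf x)$. A set $A\subset S^2$ is *non-overlapping* if distinct elements have disjoint $\Delta$'s. $P$ is *computable* if there is a computable $p:S^2\times\mathbb N\to\mathbb Q$ with $|P(\mathbf x)-p(\mathbf x,k)|<1/k$ for all $\mathbf x$ and $k\ge1$. A *test* for $P$ is an r.e. set $U\subset\mathbb N\times S^2$ whose sections $U_n$ satisfy $\tilde U_{n+1}\subset\tilde U_n$ and $P(\tilde U_n)<2^{-n}$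 for all $n$; $\mathcal R^P$ is the set of $\mathbf w\in\Omega^2$ that lie in $\bigcap_n\tilde U_n$ for no test $U$ (equivalently, the complement of $\bigcap_n\tilde U_n$ for a universal test $U$). **Monotone complexity.** For $F\subset S^2\times S^2$ put $F_{\mathbf p}=\{\mathbf x:(\mathbf p,\mathbf x)\in F\}$. $F$ satisfies $(M)$ if for all $\mathbf p\in S^2$, $\boldsymbol\lambda\in F_{\mathbf p}$ and $\bigvee\bigcup_{\mathbf p'\sqsubseteq\mathbf p}F_{\mathbf p'}$ exists in $(S\cup\Omega)^2$. The function defined by $F$ is $f(\mathbf p)=\bigvee\bigcup_{\mathbf p'\sqsubseteq\mathbf p,\ \mathbf p'\in S^2}F_{\mathbf p'}$ for $\mathbf p\in(S\cup\Omega)^2$; if $F$ is r.e. with $(M)$, $f$ is a *computable monotone function*. For $\mathbf x\in(S\cup\Omega)^2$ let $$Km^2_f(\mathbf x)=\min\{|p_1|+|p_2| : \mathbf x\sqsubseteq f(p_1,p_2)\},\qquad Km_f(\mathbf x)=\min\{|p| : \mathbf x\sqsubseteq f(p,\lambda)\},$$ with $\min\emptyset=\infty$ and $p_1,p_2,p\in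 S\cup\Omega$. A computable monotone function $u$ is *optimal* if for every computable monotone $f$ there is $c$ with $Km^2_u(\mathbf x)\le Km^2_f(\mathbf x)+c$ for all $\mathbf x\in(S\cup\Omega)^2$. It is the *standard universal* function of an enumeration $\bar F$ if $\bar F\subset\mathbb N\times S^2\times S^2$ is r.e., its sections $F_i$ all satisfy $(M)$, every r.e. $F$ with $(M)$ equals some $F_i$, and $u$ is the function defined by $\{((0^i1p_1,p_2),\mathbf x):(i,(p_1,p_2),\mathbf x)\in\bar F\}$. **Theorem (Levin–Schnorr theorem on product space).** Let $P$ be a computable probability on $\Omega^2$ and let $\mathcal A\subset S^2$ be an r.e. set such that 1. for all $\mathbf x,\mathbf y\in\mathcal A$, $\mathbf x$ and $\mathbf y$ are comparable or $\Delta(\mathbf x)\cap\Delta(\mathbf y)=\emptyset$; 2. for all $\mathbf x,\mathbf y\in\mathcal A$ there is a non-overlapping $\alpha\subset\mathcal A$ with $\Delta(\mathbf x)\cap\Delta(\mathbf y)^c=\tilde\alpha$. For $\mathbf x^\infty\in\Omega^2$ let $\mathcal A(\mathbf x^\infty)=\{\mathbf x\in\mathcal A:\mathbf x\sqsubset\mathbf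 x^\infty\}$. Let $Km=Km_u$, where $u$ is the standard universal function of any enumeration $\bar F$ as above. Then for every $\mathbf x^\infty\in\Omega^2$ $$\mathbf x^\infty\in\mathcal R^P\ \Longrightarrow\ \sup_{\mathbf x\in\mathcal A(\mathbf x^\infty)}\bigl(-\log P(\mathbf x)-Km(\mathbf x)\bigr)<\infty,$$ $$\sup_{\mathbf x\in\mathcal A(\mathbf x^\infty)}\bigl(-\log P(\mathbf x)-Km(\mathbf x)\bigr)<\infty\ \text{ and }\ \mathbf x^\infty=\bigvee\mathcal A(\mathbf x^\infty)\ \Longrightarrow\ \mathbf x^\infty\in\mathcal R^P .$$ Here $-\log 0=\infty$ and $\sup\emptyset=-\infty$. Both implications also hold with $Km^2=Km^2_u$ in place of $Km$, for this $u$ and for every optimal computable monotone function $u$. -/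

import Mathlib

open MeasureTheory
open scoped ENNReal

namespace KmProd

/-- Finite binary strings. -/
abbrev Word := List Bool

/-- Infinite binary sequences. -/
abbrev Cantor := ℕ → Bool

/-- Finite or infinite binary strings. -/
inductive Str where
  | word (s : Word) : Str
  | seq (w : Cantor) : Str

/-- `x` is a prefix of `y`. -/
def Str.IsPrefix : Str → Str → Prop
  | .word s, .word t => s <+: t
  | .word s, .seq w => ∀ i (h : i < s.length), s[i] = w i
  | .seq _, .word _ => False
  | .seq v, .seq w => v = w

/-- The prefix order. On `Str × Str` it induces the componentwise prefix order. -/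
instance : PartialOrder Str where
  le := Str.IsPrefix
  le_refl x := by
    cases x with
    | word s => exact List.prefix_refl s
    | seq w => exact rfl
  le_trans x y z hxy hyz := by
    cases x <;> cases y <;> cases z <;> simp only [Str.IsPrefix] at *
    · exact hxy.trans hyz
    · intro i h
      rw [← hyz i (h.trans_le hxy.length_le), hxy.getElem h]
    · subst hyz
      exact hxy
    · exact hxy.trans hyz
  le_antisymm x y hxy hyx := by
    cases x <;> cases y <;> simp only [Str.IsPrefix] at *
    · rw [hxy.eq_of_length (le_antisymm hxy.length_le hyx.length_le)]
    · rw [hxy]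

/-- The length of a finite or infinite string. -/
def Str.length : Str → ℕ∞
  | .word s => (s.length : ℕ∞)
  | .seq _ => ⊤

/-- A pair of finite strings, as a pair of finite or infinite strings. -/
def ofWords (x : Word × Word) : Str × Str := (.word x.1, .word x.2)

/-- A pair of infinite sequences, as a pair of finite or infinite strings. -/
def ofSeqs (w : Cantor × Cantor) : Str × Str := (.seq w.1, .seq w.2)

/-- The cylinder `Δ(x)`: all pairs of infinite sequences that extend the pair `x`. -/
def cyl (x : Word × Word) : Set (Cantor × Cantor) := {w | ofWords x ≤ ofSeqs w}

/-- The union of the cylinders of the elements of `A`. -/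
def cover (A : Set (Word × Word)) : Set (Cantor × Cantor) := ⋃ x ∈ A, cyl x

/-! ### Computable probabilities and Martin-Löf randomness -/

/-- The values of `P` on cylinders are uniformly computable reals: there is a computable
rational-valued function `p` with `|P (Δ x) - p (x, k)| < 1 / k` for all `x` and all `k ≥ 1`.
The rational number `p (x, k)` is given in the form `(a - b) / (d + 1)` with naturals `a, b, d`. -/
def IsComputableProb (P : Measure (Cantor × Cantor)) : Prop :=
  ∃ a b d : (Word × Word) × ℕ → ℕ, Computable a ∧ Computable b ∧ Computable d ∧
    ∀ (x : Word × Word) (k : ℕ), 1 ≤ k →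
      |P.real (cyl x) - ((a (x, k) : ℝ) - (b (x, k) : ℝ)) / ((d (x, k) : ℝ) + 1)| < 1 / (k : ℝ)

/-- The `n`-th level of a set `U` of indexed pairs of words. -/
def level (U : Set (ℕ × Word × Word)) (n : ℕ) : Set (Word × Word) := {x | (n, x) ∈ U}

/-- Martin-Löf tests with respect to `P`. -/
structure IsTest (P : Measure (Cantor × Cantor)) (U : Set (ℕ × Word × Word)) : Prop where
  re : REPred fun z => z ∈ U
  anti : ∀ n, cover (level U (n + 1)) ⊆ cover (level U n)
  small : ∀ n, P (cover (level U n)) < (2⁻¹ : ℝ≥0∞) ^ n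

/-- The Martin-Löf random points with respect to `P`: those which no test captures. -/
def randomSet (P : Measure (Cantor × Cantor)) : Set (Cantor × Cantor) :=
  {w | ∀ U, IsTest P U → w ∉ ⋂ n, cover (level U n)}

/-- Universal Martin-Löf tests. -/
def IsUniversalTest (P : Measure (Cantor × Cantor)) (U : Set (ℕ × Word × Word)) : Prop :=
  IsTest P U ∧ ∀ V, IsTest P V → ∃ c, ∀ n, cover (level V (n + c)) ⊆ cover (level U n)

/-- The random set is the complement of the limit of any universal test. -/
theorem randomSet_eq_of_universal {P : Measure (Cantor × Cantor)} {U : Set (ℕ × Word × Word)}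
    (hU : IsUniversalTest P U) : randomSet P = (⋂ n, cover (level U n))ᶜ := by
  ext w
  refine ⟨fun h => h U hU.1, fun h V hV hw => h ?_⟩
  obtain ⟨c, hc⟩ := hU.2 V hV
  exact Set.mem_iInter.2 fun n => hc n (Set.mem_iInter.1 hw (n + c))

/-! ### Computable monotone functions and monotone complexity -/

/-- The union of the sections `F_{p'}` over all finite `p'` below `p`. -/
def below (F : Set ((Word × Word) × (Word × Word))) (p : Str × Str) : Set (Str × Str) :=
  {x | ∃ p' x', (p', x') ∈ F ∧ ofWords p' ≤ p ∧ x = ofWords x'}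

/-- The empty pair lies in every section of `F`, and for each finite `p` the union of the
sections below `p` has a least upper bound. -/
def MonotoneCondition (F : Set ((Word × Word) × (Word × Word))) : Prop :=
  ∀ p : Word × Word, (p, (([], []) : Word × Word)) ∈ F ∧ ∃ z, IsLUB (below F (ofWords p)) z

/-- `f` is the function defined by `F`: `f p` is the supremum of the sections of `F` below `p`. -/
def IsDefinedBy (F : Set ((Word × Word) × (Word × Word))) (f : Str × Str → Str × Str) : Prop :=
  ∀ p, IsLUB (below F p) (f p)

/-- Computable monotone functions. -/
def IsComputableMonotone (f : Str × Str → Str × Str) : Prop :=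
  ∃ F, (REPred fun z => z ∈ F) ∧ MonotoneCondition F ∧ IsDefinedBy F f

/-- The complexity `Km²_f`: the least total length of a pair of programs. -/
noncomputable def Km2 (f : Str × Str → Str × Str) (x : Str × Str) : ℕ∞ :=
  ⨅ (p : Str × Str) (_ : x ≤ f p), p.1.length + p.2.length

/-- The complexity `Km_f`: the least length of a program in the first component, the second
component being empty. -/
noncomputable def Km (f : Str × Str → Str × Str) (x : Str × Str) : ℕ∞ :=
  ⨅ (p : Str) (_ : x ≤ f (p, .word [])), p.length

/-- Optimal computable monotone functions. -/
def IsOptimal (u : Str × Str → Str × Str) : Prop :=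
  IsComputableMonotone u ∧
    ∀ f, IsComputableMonotone f → ∃ c : ℕ, ∀ x : Str × Str, Km2 u x ≤ Km2 f x + c

/-- The `i`-th set in a family of relations. -/
def slice (E : Set (ℕ × (Word × Word) × (Word × Word))) (i : ℕ) :
    Set ((Word × Word) × (Word × Word)) := {z | (i, z) ∈ E}

/-- `E` is an r.e. enumeration of exactly the r.e. relations that satisfy the monotonicity
condition. -/
structure IsUniversalEnumeration (E : Set (ℕ × (Word × Word) × (Word × Word))) : Prop where
  re : REPred fun z => z ∈ E
  mono : ∀ i, MonotoneCondition (slice E i)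
  exhaust : ∀ F, (REPred fun z => z ∈ F) → MonotoneCondition F → ∃ i, F = slice E i

/-- The universal relation: the program `(0^i 1 p₁, p₂)` acts as `(p₁, p₂)` does in the `i`-th
relation of the family. -/
def universalRel (E : Set (ℕ × (Word × Word) × (Word × Word))) :
    Set ((Word × Word) × (Word × Word)) :=
  {z | ∃ i p₁ p₂ x, (i, (p₁, p₂), x) ∈ E ∧ z = ((List.replicate i false ++ true :: p₁, p₂), x)}

/-- `u` is a universal monotone function: the function that the universal relation of some
enumeration of all computable monotone functions defines. -/
def IsUniversalMonotone (u : Str × Str → Str × Str) : Prop :=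
  ∃ E, IsUniversalEnumeration E ∧ IsDefinedBy (universalRel E) u

/-! ### The sets of prefixes -/

/-- `A(w)`: the prefixes of `w` that lie in `A`. -/
def prefixesIn (A : Set (Word × Word)) (w : Cantor × Cantor) : Set (Word × Word) :=
  {x ∈ A | ofWords x ≤ ofSeqs w}

/-- Two elements of `A` are comparable or have disjoint cylinders. -/
def PartitionCondition₁ (A : Set (Word × Word)) : Prop :=
  ∀ x ∈ A, ∀ y ∈ A,
    ofWords x ≤ ofWords y ∨ ofWords y ≤ ofWords x ∨ cyl x ∩ cyl y = ∅

/-- Distinct elements of `α` have disjoint cylinders. -/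
def NonOverlapping (α : Set (Word × Word)) : Prop :=
  ∀ x ∈ α, ∀ y ∈ α, x ≠ y → cyl x ∩ cyl y = ∅

/-- The difference of two cylinders of elements of `A` is a disjoint union of cylinders of
elements of `A`. -/
def PartitionCondition₂ (A : Set (Word × Word)) : Prop :=
  ∀ x ∈ A, ∀ y ∈ A, ∃ α ⊆ A, NonOverlapping α ∧ cyl x ∩ (cyl y)ᶜ = cover α

/-- The base-2 logarithm, with `log 0 = -∞`. -/
noncomputable def log2 (a : ℝ≥0∞) : EReal := ENNReal.log a / ((Real.log 2 : ℝ) : EReal)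

/-- The supremum of `-log P(x) - K(x)` over the prefixes `x` of `w` that lie in `A`
(`-∞` if there are none). -/
noncomputable def supDeficiency (P : Measure (Cantor × Cantor)) (A : Set (Word × Word))
    (K : Str × Str → ℕ∞) (w : Cantor × Cantor) : EReal :=
  ⨆ x ∈ prefixesIn A w, (-log2 (P (cyl x)) - ((K (ofWords x) : ℝ≥0∞) : EReal))

end KmProd

open KmProd

namespace KmProd

/-! ### Recursively enumerable predicates -/

section RE

variable {α β γ σ : Type} [Primcodable α] [Primcodable β] [Primcodable γ] [Primcodable σ]

/-! Both directions compare `P` with the lengths of programs, and both work with `Km2` and `Km` at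
once because `Km2 u ≤ Km u`: it suffices to bound the deficiency for `Km2` at random points and to
make the deficiency for `Km` infinite at the other points in question.

Random points: collect in level `n` those `x ∈ A` that have a program pair `p` with `P (cyl x)`
below `2⁻¹ ^ (n + 1)` times `2` to the minus total length of `p`. Minimal elements of the level have
disjoint cylinders by the first partition condition, so their programs have no common extension.
Incompatible pairs of words span disjoint rectangles, so the uniform measure on the product gives
the Kraft inequality, and the levels form a test (`measure_cover_le`, `exists_bound_of_random`).

Non-random points: let `w` be captured by a test and be the supremum of its prefixes in `A`. The
second partition condition and compactness allow each level `2 * n + 2` of the test, restricted to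
`A`, to be enumerated by elements with disjoint cylinders (`exists_disjoint_enumeration`). The
weights `2 ^ n * P (cyl x)` then sum to at most `1/2`, so successive subintervals of `[0, 1]`
slightly longer than these weights can be assigned computably (`exists_intervals`). A machine
reading a binary code of a dyadic interval inside the `j`-th subinterval prints the `j`-th element
(`exists_machine`). It gives `x` a program of length about `-log P (cyl x) - n`, using the first
component only. Universality or optimality costs a constant, while `n` is arbitrary. -/

theorem exists_primrec_of_rePred {p : α → Prop} (hp : REPred p) :
    ∃ g : α → ℕ → Bool, Primrec₂ g ∧ (∀ a m n, m ≤ n → g a m = true → g a n = true) ∧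
      ∀ a, p a ↔ ∃ n, g a n = true := by
  obtain ⟨c, hc⟩ := Nat.Partrec.Code.exists_code.1 hp
  refine ⟨fun a k => (c.evaln k (Encodable.encode a)).isSome, ?_, ?_, ?_⟩
  · exact Primrec.option_isSome.comp (Nat.Partrec.Code.primrec_evaln.comp
      ((Primrec.snd.pair (Primrec.const c)).pair (Primrec.encode.comp Primrec.fst)))
  · intro a m n hmn h
    obtain ⟨x, hx⟩ := Option.isSome_iff_exists.1 h
    exact Option.isSome_iff_exists.2 ⟨x, Nat.Partrec.Code.evaln_mono hmn hx⟩
  · intro a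
    have hdom : (c.eval (Encodable.encode a)).Dom ↔ p a := by
      rw [hc]
      simp [Part.assert]
    rw [← hdom]
    constructor
    · intro h
      obtain ⟨k, hk⟩ := Nat.Partrec.Code.evaln_complete.1 (Part.get_mem h)
      exact ⟨k, Option.isSome_iff_exists.2 ⟨_, hk⟩⟩
    · rintro ⟨k, hk⟩
      obtain ⟨x, hx⟩ := Option.isSome_iff_exists.1 hk
      exact Part.dom_iff_mem.2 ⟨x, Nat.Partrec.Code.evaln_sound hx⟩

theorem rePred_exists_nat {g : α → ℕ → Bool} (hg : Computable₂ g) :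
    REPred fun a => ∃ n, g a n = true := by
  have h : Partrec fun a => Nat.rfind fun n => Part.some (g a n) :=
    Partrec.rfind (p := fun a n => Part.some (g a n)) hg.partrec₂
  refine h.dom_re.of_eq fun a => ?_
  refine Nat.rfind_dom.trans ?_
  constructor
  · rintro ⟨n, hn, -⟩
    obtain ⟨_, hn⟩ := hn
    exact ⟨n, hn⟩
  · rintro ⟨n, hn⟩
    exact ⟨n, ⟨trivial, hn⟩, fun _ => trivial⟩

theorem rePred_of_computable {g : α → Bool} (hg : Computable g) : REPred fun a => g a = true :=
  (rePred_exists_nat (g := fun a _ => g a) (hg.comp Computable.fst)).of_eq fun a => by simp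

theorem _root_.REPred.comp {p : β → Prop} (hp : REPred p) {f : α → β} (hf : Computable f) :
    REPred fun a => p (f a) := by
  obtain ⟨g, hg, -, h⟩ := exists_primrec_of_rePred hp
  refine (rePred_exists_nat (g := fun a n => g (f a) n) ?_).of_eq fun a => (h _).symm
  exact hg.to_comp.comp (hf.comp Computable.fst) Computable.snd

theorem rePred_rel {R : β → γ → Prop} (hR : PrimrecRel R) {f : α → β} {g : α → γ}
    (hf : Computable f) (hg : Computable g) : REPred fun a => R (f a) (g a) := by
  classical
  have h := primrecRel_iff_primrec_decide.1 hR
  refine (rePred_of_computable (g := fun a => decide (R (f a) (g a)))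
    (h.to_comp.comp hf hg)).of_eq fun a => by simp

theorem rePred_eq {f g : α → β} (hf : Computable f) (hg : Computable g) :
    REPred fun a => f a = g a := rePred_rel Primrec.eq hf hg

theorem rePred_le {f g : α → ℕ} (hf : Computable f) (hg : Computable g) :
    REPred fun a => f a ≤ g a := rePred_rel Primrec.nat_le hf hg

theorem rePred_lt {f g : α → ℕ} (hf : Computable f) (hg : Computable g) :
    REPred fun a => f a < g a := rePred_rel Primrec.nat_lt hf hg

theorem _root_.REPred.and {p q : α → Prop} (hp : REPred p) (hq : REPred q) :
    REPred fun a => p a ∧ q a := by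
  obtain ⟨g, hg, hgm, h⟩ := exists_primrec_of_rePred hp
  obtain ⟨g', hg', hgm', h'⟩ := exists_primrec_of_rePred hq
  refine (rePred_exists_nat (g := fun a n => g a n && g' a n)
    (Primrec.and.comp hg hg').to_comp).of_eq fun a => ?_
  simp only [Bool.and_eq_true, h, h']
  constructor
  · rintro ⟨n, hn, hn'⟩
    exact ⟨⟨n, hn⟩, n, hn'⟩
  · rintro ⟨⟨n, hn⟩, m, hm⟩
    exact ⟨max n m, hgm _ _ _ (le_max_left _ _) hn, hgm' _ _ _ (le_max_right _ _) hm⟩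

theorem _root_.REPred.or {p q : α → Prop} (hp : REPred p) (hq : REPred q) :
    REPred fun a => p a ∨ q a := by
  obtain ⟨g, hg, hgm, h⟩ := exists_primrec_of_rePred hp
  obtain ⟨g', hg', hgm', h'⟩ := exists_primrec_of_rePred hq
  refine (rePred_exists_nat (g := fun a n => g a n || g' a n)
    (Primrec.or.comp hg hg').to_comp).of_eq fun a => ?_
  simp only [Bool.or_eq_true, h, h', exists_or]

theorem rePred_exists {p : α → β → Prop} (hp : REPred fun x : α × β => p x.1 x.2) :
    REPred fun a => ∃ b, p a b := by
  obtain ⟨g, hg, -, h⟩ := exists_primrec_of_rePred hp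
  refine (rePred_exists_nat (g := fun a n => Option.casesOn (Encodable.decode (α := β) n.unpair.1)
    false fun b => g (a, b) n.unpair.2) ?_).of_eq fun a => ?_
  · refine Primrec.to_comp (Primrec.option_casesOn ?_ (Primrec.const _) ?_)
    · exact Primrec.decode.comp (Primrec.fst.comp (Primrec.unpair.comp Primrec.snd))
    · exact hg.comp ((Primrec.fst.comp Primrec.fst).pair Primrec.snd)
        (Primrec.snd.comp (Primrec.unpair.comp (Primrec.snd.comp Primrec.fst)))
  · constructor
    · rintro ⟨n, hn⟩
      cases hd : Encodable.decode (α := β) n.unpair.1 with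
      | none => simp [hd] at hn
      | some b => exact ⟨b, (h (a, b)).2 ⟨_, by simpa [hd] using hn⟩⟩
    · rintro ⟨b, hb⟩
      obtain ⟨k, hk⟩ := (h (a, b)).1 hb
      exact ⟨Nat.pair (Encodable.encode b) k, by simpa using hk⟩

theorem rePred_forall_mem_list {p : α → β → Prop} (hp : REPred fun x : α × β => p x.1 x.2)
    {l : α → List β} (hl : Computable l) : REPred fun a => ∀ b ∈ l a, p a b := by
  obtain ⟨g, hg, hgm, h⟩ := exists_primrec_of_rePred hp
  have hR : PrimrecRel fun (b : β) (x : α × ℕ) => g (x.1, b) x.2 = true :=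
    Primrec.eq.comp (hg.comp ((Primrec.fst.comp Primrec.snd).pair Primrec.fst)
      (Primrec.snd.comp Primrec.snd)) (Primrec.const true)
  refine (rePred_exists (p := fun a n => ∀ b ∈ l a, g (a, b) n = true)
    (rePred_rel hR.forall_mem_list (hl.comp Computable.fst) Computable.id)).of_eq fun a => ?_
  constructor
  · rintro ⟨n, hn⟩ b hb
    exact (h (a, b)).2 ⟨n, hn b hb⟩
  · intro hall
    suffices H : ∀ L : List β, (∀ b ∈ L, p a b) → ∃ n, ∀ b ∈ L, g (a, b) n = true from H _ hall
    intro L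
    induction L with
    | nil => simp
    | cons b L ih =>
      intro hL
      obtain ⟨n, hn⟩ := ih fun b hb => hL b (List.mem_cons_of_mem _ hb)
      obtain ⟨m, hm⟩ := (h (a, b)).1 (hL b List.mem_cons_self)
      refine ⟨max n m, fun c hc => ?_⟩
      rcases List.mem_cons.1 hc with rfl | hc
      · exact hgm _ _ _ (le_max_right _ _) hm
      · exact hgm _ _ _ (le_max_left _ _) (hn c hc)

theorem exists_enumeration {p : α → Prop} (hp : REPred p) :
    ∃ e : ℕ → Option α, Computable e ∧ ∀ a, p a ↔ ∃ n, e n = some a := by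
  obtain ⟨g, hg, -, h⟩ := exists_primrec_of_rePred hp
  refine ⟨fun n => Option.casesOn (Encodable.decode (α := α) n.unpair.1) none
    fun a => bif g a n.unpair.2 then some a else none, ?_, fun a => ?_⟩
  · refine Primrec.to_comp (Primrec.option_casesOn ?_ (Primrec.const _) ?_)
    · exact Primrec.decode.comp (Primrec.fst.comp Primrec.unpair)
    · exact Primrec.cond (hg.comp Primrec.snd (Primrec.snd.comp (Primrec.unpair.comp Primrec.fst)))
        (Primrec.option_some.comp Primrec.snd) (Primrec.const _)
  · rw [h]
    constructor
    · rintro ⟨k, hk⟩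
      exact ⟨Nat.pair (Encodable.encode a) k, by simp [hk]⟩
    · rintro ⟨n, hn⟩
      cases hd : Encodable.decode (α := α) n.unpair.1 with
      | none => simp [hd] at hn
      | some b =>
        cases hb : g b n.unpair.2 with
        | false => simp [hd, hb] at hn
        | true =>
          simp only [hd, hb, cond_true, Option.some.injEq] at hn
          exact ⟨_, hn ▸ hb⟩

/-- Computable dependent choice along an r.e. relation. -/
theorem exists_computable_seq {R : ℕ → σ → σ → Prop}
    (hR : REPred fun x : ℕ × σ × σ => R x.1 x.2.1 x.2.2) {I : σ → Prop} {s₀ : σ} (h₀ : I s₀)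
    (hext : ∀ n s, I s → ∃ s', R n s s') (hstep : ∀ n s s', I s → R n s s' → I s') :
    ∃ s : ℕ → σ, Computable s ∧ s 0 = s₀ ∧ ∀ n, I (s n) ∧ R n (s n) (s (n + 1)) := by
  obtain ⟨g, hg, -, h⟩ := exists_primrec_of_rePred hR
  let find : ℕ × σ → ℕ → Option σ := fun x k =>
    Option.casesOn (Encodable.decode (α := σ) k.unpair.1) none
      fun s' => bif g (x.1, x.2, s') k.unpair.2 then some s' else none
  have hfind : Computable₂ find := by
    refine Primrec.to_comp (Primrec.option_casesOn ?_ (Primrec.const _) ?_)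
    · exact Primrec.decode.comp (Primrec.fst.comp (Primrec.unpair.comp Primrec.snd))
    · exact Primrec.cond (hg.comp
        ((Primrec.fst.comp (Primrec.fst.comp Primrec.fst)).pair
          ((Primrec.snd.comp (Primrec.fst.comp Primrec.fst)).pair Primrec.snd))
        (Primrec.snd.comp (Primrec.unpair.comp (Primrec.snd.comp Primrec.fst))))
        (Primrec.option_some.comp Primrec.snd) (Primrec.const _)
  -- The search runs over pairs of a candidate and a running time. It may diverge in general; the
  -- invariant `I` makes it halt along the constructed sequence.
  let pick : ℕ × σ →. σ := fun x => Nat.rfindOpt (find x)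
  have hpick : Partrec pick := Partrec.rfindOpt hfind
  have hfind_mem : ∀ n s k s', s' ∈ find (n, s) k → R n s s' := by
    intro n s k s' hs
    refine (h (n, s, s')).2 ⟨k.unpair.2, ?_⟩
    cases hd : Encodable.decode (α := σ) k.unpair.1 with
    | none => simp [find, hd] at hs
    | some b =>
      cases hb : g (n, s, b) k.unpair.2 with
      | false => simp [find, hd, hb] at hs
      | true =>
        simp only [find, hd, hb, cond_true, Option.mem_def, Option.some.injEq] at hs
        exact hs ▸ hb
  have hpick_mem : ∀ n s s', s' ∈ pick (n, s) → R n s s' := by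
    intro n s s' hs
    obtain ⟨k, hk⟩ := Nat.rfindOpt_spec hs
    exact hfind_mem n s k s' hk
  have hpick_dom : ∀ n s, I s → (pick (n, s)).Dom := by
    intro n s hs
    obtain ⟨s', hs'⟩ := hext n s hs
    obtain ⟨k, hk⟩ := (h (n, s, s')).1 hs'
    refine Nat.rfindOpt_dom.2 ⟨Nat.pair (Encodable.encode s') k, s', ?_⟩
    simp [find, hk]
  let φ : ℕ →. σ := fun n => Nat.rec (Part.some s₀) (fun y IH => IH.bind fun i => pick (y, i)) n
  have hφ : Partrec φ :=
    Partrec.nat_rec (f := fun n : ℕ => n) (g := fun _ => Part.some s₀)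
      (h := fun _ x => pick x) Computable.id (Computable.const s₀).partrec
      (hpick.comp Computable.snd)
  have hI : ∀ n, ∃ s ∈ φ n, I s := by
    intro n
    induction n with
    | zero => exact ⟨s₀, Part.mem_some _, h₀⟩
    | succ n ih =>
      obtain ⟨s, hs, hIs⟩ := ih
      have hd := hpick_dom n s hIs
      exact ⟨_, Part.mem_bind hs (Part.get_mem hd), hstep n s _ hIs (hpick_mem _ _ _ (Part.get_mem hd))⟩
  choose s hs hIs using hI
  refine ⟨s, hφ.of_eq_tot hs, ?_, fun n => ⟨hIs n, ?_⟩⟩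
  · exact Part.mem_some_iff.1 (hs 0)
  · obtain ⟨t, ht, ht'⟩ := Part.mem_bind_iff.1 (hs (n + 1))
    rw [Part.mem_unique (hs n) ht]
    exact hpick_mem _ _ _ ht'

end RE

/-! ### Finite and infinite strings -/

theorem word_le_word {s t : Word} : Str.word s ≤ Str.word t ↔ s <+: t := Iff.rfl

theorem word_le_seq {s : Word} {w : Cantor} :
    Str.word s ≤ Str.seq w ↔ ∀ i (h : i < s.length), s[i] = w i := Iff.rfl

theorem nil_le (z : Str) : Str.word [] ≤ z := by
  cases z with
  | word t => exact List.nil_prefix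
  | seq w => exact fun i h => absurd h (Nat.not_lt_zero i)

theorem ofWords_nil_le (z : Str × Str) : ofWords ([], []) ≤ z := ⟨nil_le _, nil_le _⟩

theorem mem_cyl {x : Word × Word} {w : Cantor × Cantor} : w ∈ cyl x ↔ ofWords x ≤ ofSeqs w :=
  Iff.rfl

theorem mem_cover {B : Set (Word × Word)} {w : Cantor × Cantor} :
    w ∈ cover B ↔ ∃ x ∈ B, ofWords x ≤ ofSeqs w := by
  simp [cover, mem_cyl]

theorem cyl_subset_cover {B : Set (Word × Word)} {x : Word × Word} (hx : x ∈ B) :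
    cyl x ⊆ cover B := Set.subset_biUnion_of_mem (u := cyl) hx

theorem cover_mono {B C : Set (Word × Word)} (h : B ⊆ C) : cover B ⊆ cover C :=
  Set.biUnion_subset_biUnion_left h

theorem cyl_anti {x y : Word × Word} (h : ofWords x ≤ ofWords y) : cyl y ⊆ cyl x :=
  fun _ hw => h.trans hw

theorem word_total {s t : Word} {z : Str} (hs : Str.word s ≤ z) (ht : Str.word t ≤ z) :
    s <+: t ∨ t <+: s := by
  cases z with
  | word r => exact List.prefix_or_prefix_of_prefix hs ht
  | seq w =>
    rcases le_total s.length t.length with h | h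
    · refine Or.inl (List.prefix_iff_getElem.2 ⟨h, fun i hi => ?_⟩)
      rw [hs i hi, ht i (hi.trans_le h)]
    · refine Or.inr (List.prefix_iff_getElem.2 ⟨h, fun i hi => ?_⟩)
      rw [ht i hi, hs i (hi.trans_le h)]

/-- A finite prefix of a supremum is a prefix of an element, if it is nonempty. -/
theorem exists_le_of_isLUB {T : Set Str} {z : Str} (hT : IsLUB T z) {s : Word}
    (hs : Str.word s ≤ z) : s = [] ∨ ∃ t ∈ T, Str.word s ≤ t := by
  by_contra! h
  obtain ⟨hne, h⟩ := h
  -- Elements of `T` lie below `z`, as does `s`, so each is comparable with `s`. If none extends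
  -- `s`, all are proper prefixes of `s`, and dropping the last bit of `s` still leaves an upper
  -- bound.
  have hub : Str.word s.dropLast ∈ upperBounds T := by
    intro t ht
    have htz := hT.1 ht
    have hnle := h t ht
    cases t with
    | seq v =>
      cases z with
      | word r => exact htz.elim
      | seq w =>
        have hvw : v = w := htz
        exact absurd (hvw ▸ hs) hnle
    | word r =>
      rcases word_total hs htz with hsr | hrs
      · exact absurd hsr hnle
      · have hlen : r.length < s.length := by
          refine lt_of_le_of_ne hrs.length_le fun he => hnle ?_
          rw [hrs.eq_of_length he]
        refine List.prefix_of_prefix_length_le hrs (List.dropLast_prefix s) ?_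
        rw [List.length_dropLast]
        omega
  have hle := (hs.trans (hT.2 hub) : Str.word s ≤ Str.word s.dropLast)
  have := (word_le_word.1 hle).length_le
  rw [List.length_dropLast] at this
  have := List.length_pos_iff.2 hne
  omega

/-- The extension of a finite string by zeros. -/
def zeroExt (s : Word) : Cantor := fun i => s.getD i false

theorem le_zeroExt (s : Word) : Str.word s ≤ Str.seq (zeroExt s) := by
  intro i h
  simp [zeroExt, h]

theorem cyl_nonempty (x : Word × Word) : (cyl x).Nonempty :=
  ⟨(zeroExt x.1, zeroExt x.2), le_zeroExt _, le_zeroExt _⟩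

theorem prefix_of_forall_seq {s t : Word}
    (h : ∀ w : Cantor, Str.word s ≤ Str.seq w → Str.word t ≤ Str.seq w) : t <+: s := by
  -- This sequence extends `s` and then disagrees with `t` at every position beyond `s`.
  let w : Cantor := fun i => if h : i < s.length then s[i] else !(t.getD i false)
  have hs : Str.word s ≤ Str.seq w := fun i hi => by simp [w, hi]
  have ht := h w hs
  rcases word_total ht hs with h | h
  · exact h
  · by_cases hlt : s.length < t.length
    · have := word_le_seq.1 ht s.length hlt
      simp [w, hlt] at this
    · rw [h.eq_of_length (le_antisymm h.length_le (not_lt.1 hlt))]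

theorem ofWords_le_of_cyl_subset {x y : Word × Word} (h : cyl x ⊆ cyl y) :
    ofWords y ≤ ofWords x := by
  constructor
  · exact prefix_of_forall_seq fun w hw => (h (show (w, zeroExt x.2) ∈ cyl x from
      ⟨hw, le_zeroExt _⟩)).1
  · exact prefix_of_forall_seq fun w hw => (h (show (zeroExt x.1, w) ∈ cyl x from
      ⟨le_zeroExt _, hw⟩)).2

/-- Pairs of words with a common extension. -/
def Compatible (x y : Word × Word) : Prop :=
  (x.1 <+: y.1 ∨ y.1 <+: x.1) ∧ (x.2 <+: y.2 ∨ y.2 <+: x.2)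

theorem compatible_of_le {x y : Word × Word} {z : Str × Str} (hx : ofWords x ≤ z)
    (hy : ofWords y ≤ z) : Compatible x y :=
  ⟨word_total hx.1 hy.1, word_total hx.2 hy.2⟩

theorem exists_word_ge {s t : Word} (h : s <+: t ∨ t <+: s) :
    ∃ r : Word, s <+: r ∧ t <+: r := by
  rcases h with h | h
  · exact ⟨t, h, List.prefix_rfl⟩
  · exact ⟨s, List.prefix_rfl, h⟩

theorem Compatible.exists_ge {x y : Word × Word} (h : Compatible x y) :
    ∃ z : Word × Word, ofWords x ≤ ofWords z ∧ ofWords y ≤ ofWords z := by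
  obtain ⟨r, hr⟩ := exists_word_ge h.1
  obtain ⟨r', hr'⟩ := exists_word_ge h.2
  exact ⟨(r, r'), ⟨hr.1, hr'.1⟩, ⟨hr.2, hr'.2⟩⟩

theorem cyl_inter_eq_empty_iff {x y : Word × Word} : cyl x ∩ cyl y = ∅ ↔ ¬ Compatible x y := by
  constructor
  · intro h hc
    obtain ⟨z, hxz, hyz⟩ := hc.exists_ge
    obtain ⟨w, hw⟩ := cyl_nonempty z
    exact (h ▸ (⟨cyl_anti hxz hw, cyl_anti hyz hw⟩ : w ∈ cyl x ∩ cyl y) : w ∈ (∅ : Set _))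
  · intro h
    refine Set.eq_empty_of_forall_notMem fun w hw => h ?_
    exact compatible_of_le hw.1 hw.2

theorem disjoint_cyl_iff {x y : Word × Word} : Disjoint (cyl x) (cyl y) ↔ ¬ Compatible x y := by
  rw [Set.disjoint_iff_inter_eq_empty, cyl_inter_eq_empty_iff]

theorem isClopen_cyl (x : Word × Word) : IsClopen (cyl x) := by
  have key : cyl x = (⋂ i : Fin x.1.length, {w | x.1[i] = w.1 i}) ∩
      ⋂ i : Fin x.2.length, {w | x.2[i] = w.2 i} := by
    ext w
    simp only [Set.mem_inter_iff, Set.mem_iInter, Set.mem_ofPred_eq]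
    exact ⟨fun h => ⟨fun i => h.1 i i.2, fun i => h.2 i i.2⟩,
      fun h => ⟨fun i hi => h.1 ⟨i, hi⟩, fun i hi => h.2 ⟨i, hi⟩⟩⟩
  rw [key]
  refine IsClopen.inter (isClopen_iInter_of_finite fun i => ?_)
    (isClopen_iInter_of_finite fun i => ?_)
  · exact (isClopen_discrete {b | x.1[i] = b}).preimage ((continuous_apply _).comp continuous_fst)
  · exact (isClopen_discrete {b | x.2[i] = b}).preimage ((continuous_apply _).comp continuous_snd)

theorem measurableSet_cyl (x : Word × Word) : MeasurableSet (cyl x) :=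
  (isClopen_cyl x).isOpen.measurableSet

/-! ### The uniform measure and the Kraft inequality -/

/-- The uniform measure on infinite sequences. -/
noncomputable def uniformSeq : Measure Cantor :=
  Measure.infinitePi fun _ : ℕ => (PMF.uniformOfFintype Bool).toMeasure

instance : IsProbabilityMeasure uniformSeq := by
  unfold uniformSeq
  infer_instance

theorem uniformSeq_prefix (s : Word) :
    uniformSeq {w | Str.word s ≤ Str.seq w} = (2⁻¹ : ℝ≥0∞) ^ s.length := by
  have key : {w | Str.word s ≤ Str.seq w} =
      Set.pi (Finset.range s.length : Set ℕ) fun i => {s.getD i false} := by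
    ext w
    simp only [Set.mem_ofPred_eq, word_le_seq, Set.mem_pi, Finset.coe_range, Set.mem_Iio,
      Set.mem_singleton_iff]
    refine forall_congr' fun i => forall_congr' fun hi => ?_
    simp [hi, eq_comm]
  rw [key, uniformSeq, Measure.infinitePi_pi _ fun i _ => MeasurableSet.singleton _]
  simp

theorem uniform_cyl (x : Word × Word) :
    (uniformSeq.prod uniformSeq) (cyl x) = (2⁻¹ : ℝ≥0∞) ^ (x.1.length + x.2.length) := by
  have key : cyl x = {w | Str.word x.1 ≤ Str.seq w} ×ˢ {w | Str.word x.2 ≤ Str.seq w} := rfl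
  rw [key, Measure.prod_prod, uniformSeq_prefix, uniformSeq_prefix, pow_add]

/-- The Kraft inequality for pairs of words. -/
theorem tsum_two_pow_length_le_one {ι : Type*} [Countable ι] (p : ι → Word × Word)
    (h : Pairwise fun i j => ¬ Compatible (p i) (p j)) :
    ∑' i, (2⁻¹ : ℝ≥0∞) ^ ((p i).1.length + (p i).2.length) ≤ 1 := by
  simp_rw [← uniform_cyl]
  rw [← measure_iUnion (fun i j hij => disjoint_cyl_iff.2 (h hij)) fun i => measurableSet_cyl _]
  exact prob_le_one

/-! ### Automation for computability -/

attribute [fun_prop] Computable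
attribute [fun_prop] Computable.const
attribute [fun_prop] Computable.id
attribute [fun_prop] Computable.comp

section Calculus

variable {α β γ : Type} [Primcodable α] [Primcodable β] [Primcodable γ]

@[fun_prop]
theorem computable_fst {f : α → β × γ} (hf : Computable f) : Computable fun a => (f a).1 :=
  Computable.fst.comp hf

@[fun_prop]
theorem computable_snd {f : α → β × γ} (hf : Computable f) : Computable fun a => (f a).2 :=
  Computable.snd.comp hf

@[fun_prop]
theorem computable_pair {f : α → β} {g : α → γ} (hf : Computable f) (hg : Computable g) :
    Computable fun a => (f a, g a) :=
  hf.pair hg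

@[fun_prop]
theorem computable_add {f g : α → ℕ} (hf : Computable f) (hg : Computable g) :
    Computable fun a => f a + g a :=
  Primrec.nat_add.to_comp.comp hf hg

@[fun_prop]
theorem computable_sub {f g : α → ℕ} (hf : Computable f) (hg : Computable g) :
    Computable fun a => f a - g a :=
  Primrec.nat_sub.to_comp.comp hf hg

@[fun_prop]
theorem computable_mul {f g : α → ℕ} (hf : Computable f) (hg : Computable g) :
    Computable fun a => f a * g a :=
  Primrec.nat_mul.to_comp.comp hf hg

@[fun_prop]
theorem computable_pow {f g : α → ℕ} (hf : Computable f) (hg : Computable g) :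
    Computable fun a => f a ^ g a :=
  (Primrec₂.unpaired'.1 Nat.Primrec.pow).to_comp.comp hf hg

@[fun_prop]
theorem computable_some {f : α → β} (hf : Computable f) : Computable fun a => some (f a) :=
  Computable.option_some.comp hf

@[fun_prop]
theorem computable_unpair {f : α → ℕ} (hf : Computable f) : Computable fun a => (f a).unpair :=
  Computable.unpair.comp hf

@[fun_prop]
theorem computable_length {f : α → List β} (hf : Computable f) :
    Computable fun a => (f a).length :=
  Computable.list_length.comp hf

@[fun_prop]
theorem computable_append {f g : α → List β} (hf : Computable f) (hg : Computable g) :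
    Computable fun a => f a ++ g a :=
  Computable.list_append.comp hf hg

@[fun_prop]
theorem computable_range {f : α → ℕ} (hf : Computable f) :
    Computable fun a => List.range (f a) :=
  Primrec.list_range.to_comp.comp hf

@[fun_prop]
theorem computable_getElem? {f : α → List β} {g : α → ℕ} (hf : Computable f)
    (hg : Computable g) : Computable fun a => (f a)[g a]? :=
  Computable.list_getElem?.comp hf hg

end Calculus

theorem primrecRel_prefix : PrimrecRel fun s t : Word => s <+: t := by
  refine PrimrecPred.primrecRel (p := fun x : Word × Word => x.1 <+: x.2) ?_
  refine (PrimrecRel.comp Primrec.eq Primrec.fst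
    (Primrec.list_take.comp (Primrec.list_length.comp Primrec.fst) Primrec.snd)).of_eq
    fun x => ?_
  exact List.prefix_iff_eq_take.symm

theorem rePred_prefix {α : Type} [Primcodable α] {f g : α → Word} (hf : Computable f)
    (hg : Computable g) : REPred fun a => f a <+: g a :=
  rePred_rel primrecRel_prefix hf hg

theorem rePred_ofWords_le {α : Type} [Primcodable α] {f g : α → Word × Word} (hf : Computable f)
    (hg : Computable g) : REPred fun a => ofWords (f a) ≤ ofWords (g a) :=
  (rePred_prefix (computable_fst hf) (computable_fst hg)).and
    (rePred_prefix (computable_snd hf) (computable_snd hg))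

/-! ### Approximation of the measure of cylinders -/

theorem measure_lt_two_pow_iff {P : Measure (Cantor × Cantor)} [IsProbabilityMeasure P]
    {S : Set (Cantor × Cantor)} {k : ℕ} :
    P S < (2⁻¹ : ℝ≥0∞) ^ k ↔ P.real S < (2⁻¹ : ℝ) ^ k := by
  have h : (2⁻¹ : ℝ≥0∞) ^ k = ENNReal.ofReal ((2⁻¹ : ℝ) ^ k) := by
    rw [ENNReal.ofReal_pow (by norm_num), ENNReal.ofReal_inv_of_pos (by norm_num)]
    norm_num
  rw [← ofReal_measureReal (μ := P) (s := S), h]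
  exact ENNReal.ofReal_lt_ofReal_iff (by positivity)

/-- Computable strict upper approximations of a computable probability. -/
theorem IsComputableProb.exists_upper {P : Measure (Cantor × Cantor)} (hP : IsComputableProb P) :
    ∃ a b : (Word × Word) × ℕ → ℕ, Computable a ∧ Computable b ∧ ∀ x m, 0 < b (x, m) ∧
      P.real (cyl x) < (a (x, m) : ℝ) / b (x, m) ∧
      (a (x, m) : ℝ) / b (x, m) < P.real (cyl x) + (2⁻¹ : ℝ) ^ m := by
  obtain ⟨a, b, d, ha, hb, hd, h⟩ := hP
  -- The approximation with error `1 / k`, for `k = 2 ^ (m + 1)`, is raised by `1 / k`. It then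
  -- exceeds the true value by a positive amount less than `2 / k = 2⁻¹ ^ m`.
  refine ⟨fun z => a (z.1, 2 ^ (z.2 + 1)) * 2 ^ (z.2 + 1) + (d (z.1, 2 ^ (z.2 + 1)) + 1) -
      b (z.1, 2 ^ (z.2 + 1)) * 2 ^ (z.2 + 1),
    fun z => (d (z.1, 2 ^ (z.2 + 1)) + 1) * 2 ^ (z.2 + 1), by fun_prop, by fun_prop,
    fun x m => ⟨by positivity, ?_⟩⟩
  have hk := h x (2 ^ (m + 1)) Nat.one_le_two_pow
  simp only
  generalize a (x, 2 ^ (m + 1)) = A at *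
  generalize b (x, 2 ^ (m + 1)) = B at *
  generalize d (x, 2 ^ (m + 1)) = E at *
  have hp0 : 0 ≤ P.real (cyl x) := measureReal_nonneg
  have hpow : (2⁻¹ : ℝ) ^ m = 1 / (2 ^ (m + 1) : ℕ) + 1 / (2 ^ (m + 1) : ℕ) := by
    push_cast
    rw [pow_succ, inv_pow]
    field_simp
    norm_num
  have hkpos : (0 : ℝ) < (2 ^ (m + 1) : ℕ) := by positivity
  rw [hpow]
  generalize (2 ^ (m + 1) : ℕ) = k at *
  have hE : (0 : ℝ) < (E : ℝ) + 1 := by positivity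
  have hq : ((A : ℝ) * k + (E + 1) - B * k) / ((E + 1) * k) =
      ((A : ℝ) - B) / (E + 1) + 1 / k := by
    field_simp
    ring
  obtain ⟨h1, h2⟩ := abs_lt.1 hk
  -- The raised value exceeds a probability, so the numerator is positive and the truncated
  -- subtraction in `ℕ` is exact.
  have hnum : (0 : ℝ) < (A : ℝ) * k + (E + 1) - B * k := by
    by_contra hneg
    have := div_nonpos_of_nonpos_of_nonneg (not_lt.1 hneg) (mul_pos hE hkpos).le
    rw [hq] at this
    linarith
  have hle : B * k ≤ A * k + (E + 1) := by
    have : (B * k : ℝ) ≤ A * k + (E + 1) := by linarith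
    exact_mod_cast this
  rw [Nat.cast_sub hle]
  push_cast
  rw [hq]
  constructor <;> linarith

/-- A strict inequality of this kind holds exactly when some upper approximation already confirms
it, so it can be found by search over the precision. -/
theorem rePred_measure_lt {P : Measure (Cantor × Cantor)} [IsProbabilityMeasure P]
    (hP : IsComputableProb P) {α : Type} [Primcodable α] {f : α → Word × Word} {g : α → ℕ}
    (hf : Computable f) (hg : Computable g) :
    REPred fun z => P (cyl (f z)) < (2⁻¹ : ℝ≥0∞) ^ g z := by
  obtain ⟨a, b, ha, hb, h⟩ := hP.exists_upper
  refine (rePred_exists (p := fun z m => a (f z, m) * 2 ^ g z < b (f z, m))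
    (rePred_lt (by fun_prop) (by fun_prop))).of_eq fun z => ?_
  rw [measure_lt_two_pow_iff]
  have key : ∀ m, a (f z, m) * 2 ^ g z < b (f z, m) ↔
      (a (f z, m) : ℝ) / b (f z, m) < (2⁻¹ : ℝ) ^ g z := by
    intro m
    have hb0 : (0 : ℝ) < b (f z, m) := by exact_mod_cast (h (f z) m).1
    rw [div_lt_iff₀ hb0, inv_pow, inv_mul_eq_div, lt_div_iff₀ (by positivity)]
    exact_mod_cast Iff.rfl
  simp_rw [key]
  constructor
  · rintro ⟨m, hm⟩
    exact (h (f z) m).2.1.trans hm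
  · intro hlt
    obtain ⟨m, hm⟩ := exists_pow_lt_of_lt_one (sub_pos.2 hlt) (by norm_num : (2⁻¹ : ℝ) < 1)
    exact ⟨m, (h (f z) m).2.2.trans (by linarith)⟩

/-! ### Random points have bounded deficiency -/

/-- Suprema of pairs are componentwise, and a nonempty finite prefix of a supremum is reached by a
single element. The two components may have different witnesses. The resulting condition is
existential over `F`, hence r.e. when `F` is. -/
theorem ofWords_le_apply_iff {F : Set ((Word × Word) × (Word × Word))} {u : Str × Str → Str × Str}
    (hu : IsDefinedBy F u) {p x : Word × Word} :
    ofWords x ≤ u (ofWords p) ↔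
      (x.1 = [] ∨ ∃ z, z ∈ F ∧ ofWords z.1 ≤ ofWords p ∧ x.1 <+: z.2.1) ∧
      (x.2 = [] ∨ ∃ z, z ∈ F ∧ ofWords z.1 ≤ ofWords p ∧ x.2 <+: z.2.2) := by
  have h := isLUB_prod.1 (hu (ofWords p))
  constructor
  · rintro ⟨h1, h2⟩
    constructor
    · rcases exists_le_of_isLUB h.1 h1 with h1 | ⟨t, ⟨_, ⟨q, y, hz, hq, rfl⟩, rfl⟩, ht⟩
      · exact Or.inl h1
      · exact Or.inr ⟨(q, y), hz, hq, ht⟩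
    · rcases exists_le_of_isLUB h.2 h2 with h1 | ⟨t, ⟨_, ⟨q, y, hz, hq, rfl⟩, rfl⟩, ht⟩
      · exact Or.inl h1
      · exact Or.inr ⟨(q, y), hz, hq, ht⟩
  · rintro ⟨h1, h2⟩
    constructor
    · rcases h1 with h1 | ⟨z, hz, hq, ht⟩
      · simpa [ofWords, h1] using nil_le _
      · exact (show Str.word x.1 ≤ Str.word z.2.1 from ht).trans
          (h.1.1 ⟨ofWords z.2, ⟨z.1, z.2, hz, hq, rfl⟩, rfl⟩)
    · rcases h2 with h1 | ⟨z, hz, hq, ht⟩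
      · simpa [ofWords, h1] using nil_le _
      · exact (show Str.word x.2 ≤ Str.word z.2.2 from ht).trans
          (h.2.1 ⟨ofWords z.2, ⟨z.1, z.2, hz, hq, rfl⟩, rfl⟩)

theorem rePred_le_apply {F : Set ((Word × Word) × (Word × Word))} (hF : REPred fun z => z ∈ F)
    {u : Str × Str → Str × Str} (hu : IsDefinedBy F u) {α : Type} [Primcodable α]
    {f g : α → Word × Word} (hf : Computable f) (hg : Computable g) :
    REPred fun a => ofWords (f a) ≤ u (ofWords (g a)) := by
  simp_rw [ofWords_le_apply_iff hu]
  refine REPred.and (REPred.or (rePred_eq (by fun_prop) (by fun_prop)) ?_)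
    (REPred.or (rePred_eq (by fun_prop) (by fun_prop)) ?_)
  · exact rePred_exists ((hF.comp (by fun_prop)).and
      ((rePred_ofWords_le (by fun_prop) (by fun_prop)).and
        (rePred_prefix (by fun_prop) (by fun_prop))))
  · exact rePred_exists ((hF.comp (by fun_prop)).and
      ((rePred_ofWords_le (by fun_prop) (by fun_prop)).and
        (rePred_prefix (by fun_prop) (by fun_prop))))

theorem IsDefinedBy.mono {F : Set ((Word × Word) × (Word × Word))} {u : Str × Str → Str × Str}
    (hu : IsDefinedBy F u) {p q : Str × Str} (h : p ≤ q) : u p ≤ u q :=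
  (hu p).mono (hu q) fun _ ⟨p', x', hF, hp, hx⟩ => ⟨p', x', hF, hp.trans h, hx⟩

/-- The minimal elements of a set of pairs of words. -/
def minimals (B : Set (Word × Word)) : Set (Word × Word) :=
  {x ∈ B | ∀ y ∈ B, ofWords y ≤ ofWords x → y = x}

theorem exists_minimal_le {B : Set (Word × Word)} {x : Word × Word} (hx : x ∈ B) :
    ∃ y ∈ minimals B, ofWords y ≤ ofWords x := by
  obtain ⟨y, ⟨hyB, hyx⟩, hmin⟩ := exists_minimalFor_of_wellFoundedLT
    (fun y : Word × Word => y ∈ B ∧ ofWords y ≤ ofWords x) (fun y => y.1.length + y.2.length)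
    ⟨x, hx, le_rfl⟩
  refine ⟨y, ⟨hyB, fun z hz hzy => ?_⟩, hyx⟩
  have h := hmin (show z ∈ B ∧ ofWords z ≤ ofWords x from ⟨hz, hzy.trans hyx⟩)
  have h1 := hzy.1.length_le
  have h2 := hzy.2.length_le
  have := h (by simp only; omega)
  simp only at this
  exact Prod.ext (hzy.1.eq_of_length (by omega)) (hzy.2.eq_of_length (by omega))

theorem cover_minimals (B : Set (Word × Word)) : cover (minimals B) = cover B := by
  refine (cover_mono fun x hx => hx.1).antisymm fun w hw => ?_
  obtain ⟨x, hx, hxw⟩ := mem_cover.1 hw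
  obtain ⟨y, hy, hyx⟩ := exists_minimal_le hx
  exact mem_cover.2 ⟨y, hy, hyx.trans hxw⟩

/-- Passing to minimal elements keeps the cover and makes the chosen programs incompatible, so the
Kraft inequality bounds the sum of the measures. -/
theorem measure_cover_le {P : Measure (Cantor × Cantor)} {A : Set (Word × Word)}
    (hA₁ : PartitionCondition₁ A) {u : Str × Str → Str × Str}
    (hu : ∀ p q, p ≤ q → u p ≤ u q) {n : ℕ} {B : Set (Word × Word)} (hBA : B ⊆ A)
    (hB : ∀ x ∈ B, ∃ p : Word × Word, ofWords x ≤ u (ofWords p) ∧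
      P (cyl x) ≤ (2⁻¹ : ℝ≥0∞) ^ (n + (p.1.length + p.2.length))) :
    P (cover B) ≤ (2⁻¹ : ℝ≥0∞) ^ n := by
  choose! p hp hpP using hB
  rw [← cover_minimals]
  have hincomp : Pairwise fun x y : minimals B => ¬ Compatible (p x) (p y) := by
    intro x y hxy hc
    -- A common extension `q` of the programs would put `x` and `y` below the same value `u (ofWords
    -- q)`. Their cylinders would then meet, so they would be comparable and, by minimality, equal.
    obtain ⟨q, hxq, hyq⟩ := hc.exists_ge
    have hcomp : ¬ Disjoint (cyl x.1) (cyl y.1) := by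
      rw [disjoint_cyl_iff, not_not]
      exact compatible_of_le ((hp x x.2.1).trans (hu _ _ hxq)) ((hp y y.2.1).trans (hu _ _ hyq))
    rcases hA₁ x (hBA x.2.1) y (hBA y.2.1) with h | h | h
    · exact hxy (Subtype.ext (y.2.2 x x.2.1 h))
    · exact hxy (Subtype.ext (x.2.2 y y.2.1 h)).symm
    · exact hcomp (Set.disjoint_iff_inter_eq_empty.2 h)
  calc P (cover (minimals B)) = P (⋃ x : minimals B, cyl x.1) := by
        rw [cover, Set.biUnion_eq_iUnion]
    _ ≤ ∑' x : minimals B, P (cyl x.1) := measure_iUnion_le _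
    _ ≤ ∑' x : minimals B, (2⁻¹ : ℝ≥0∞) ^ n *
          (2⁻¹ : ℝ≥0∞) ^ ((p x.1).1.length + (p x.1).2.length) :=
        ENNReal.tsum_le_tsum fun x => (hpP x x.2.1).trans (pow_add _ _ _).le
    _ = (2⁻¹ : ℝ≥0∞) ^ n *
          ∑' x : minimals B, (2⁻¹ : ℝ≥0∞) ^ ((p x.1).1.length + (p x.1).2.length) :=
        ENNReal.tsum_mul_left
    _ ≤ (2⁻¹ : ℝ≥0∞) ^ n * 1 := by
        gcongr
        exact tsum_two_pow_length_le_one _ hincomp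
    _ = _ := mul_one _

theorem two_inv_pow_lt_of_lt {m n : ℕ} (h : m < n) : (2⁻¹ : ℝ≥0∞) ^ n < 2⁻¹ ^ m := by
  rw [← ENNReal.inv_pow, ← ENNReal.inv_pow, ENNReal.inv_lt_inv]
  exact_mod_cast Nat.pow_lt_pow_right one_lt_two h

theorem exists_bound_of_random {P : Measure (Cantor × Cantor)} [IsProbabilityMeasure P]
    (hP : IsComputableProb P) {A : Set (Word × Word)} (hA : REPred fun x => x ∈ A)
    (hA₁ : PartitionCondition₁ A) {F : Set ((Word × Word) × (Word × Word))}
    (hF : REPred fun z => z ∈ F) {u : Str × Str → Str × Str} (hu : IsDefinedBy F u)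
    {w : Cantor × Cantor} (hw : w ∈ randomSet P) :
    ∃ n : ℕ, ∀ x ∈ prefixesIn A w, ∀ p : Word × Word, ofWords x ≤ u (ofWords p) →
      (2⁻¹ : ℝ≥0∞) ^ (n + (p.1.length + p.2.length)) ≤ P (cyl x) := by
  -- The shift `z.1 + 1` turns the non-strict bound of `measure_cover_le` into the strict one
  -- required of a test.
  let U : Set (ℕ × Word × Word) := {z | z.2 ∈ A ∧ ∃ p : Word × Word, ofWords z.2 ≤ u (ofWords p) ∧
    P (cyl z.2) < (2⁻¹ : ℝ≥0∞) ^ (z.1 + 1 + (p.1.length + p.2.length))}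
  have hU : IsTest P U := by
    refine ⟨?_, fun n => cover_mono ?_, fun n => ?_⟩
    · refine (hA.comp Computable.snd).and (rePred_exists ((rePred_le_apply hF hu ?_ ?_).and
        (rePred_measure_lt hP ?_ ?_)))
      all_goals fun_prop
    · rintro x ⟨hxA, p, hp, hpP⟩
      exact ⟨hxA, p, hp, hpP.trans (two_inv_pow_lt_of_lt (by simp only; omega))⟩
    · refine (measure_cover_le (n := n + 1) hA₁ (fun _ _ h => hu.mono h) (fun x hx => hx.1)
        fun x hx => ?_).trans_lt (two_inv_pow_lt_of_lt (Nat.lt_succ_self n))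
      obtain ⟨-, p, hp, hpP⟩ := hx
      exact ⟨p, hp, hpP.le⟩
  obtain ⟨n, hn⟩ := not_forall.1 (Set.mem_iInter.not.1 (hw U hU))
  refine ⟨n + 1, fun x hx p hp => not_lt.1 fun hlt => hn ?_⟩
  exact mem_cover.2 ⟨x, ⟨hx.1, p, hp, hlt⟩, hx.2⟩

/-! ### Disjoint enumerations -/

/-- The difference of cylinders is closed in a compact space and the cylinders are open. Finiteness
lets a partition be found by search among finite lists. -/
theorem exists_finite_subcover {α : Set (Word × Word)} {x y : Word × Word}
    (h : cyl x ∩ (cyl y)ᶜ = cover α) : ∃ β ⊆ α, β.Finite ∧ cover β = cyl x ∩ (cyl y)ᶜ := by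
  have hcomp : IsCompact (cyl x ∩ (cyl y)ᶜ) :=
    ((isClopen_cyl x).inter (isClopen_cyl y).compl).isClosed.isCompact
  obtain ⟨β, hβ, hfin, hcov⟩ := hcomp.elim_finite_subcover_image (b := α) (c := cyl)
    (fun z _ => (isClopen_cyl z).isOpen) h.le
  exact ⟨β, hβ, hfin, ((cover_mono hβ).trans h.ge).antisymm hcov⟩

/-- A cylinder minus finitely many cylinders of elements of `A` is a finite disjoint union of
cylinders of elements of `A`. -/
theorem exists_finite_partition_sdiff {A : Set (Word × Word)} (hA₂ : PartitionCondition₂ A)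
    {x : Word × Word} (hx : x ∈ A) {L : Set (Word × Word)} (hL : L.Finite) (hLA : L ⊆ A) :
    ∃ β ⊆ A, β.Finite ∧ NonOverlapping β ∧ cover β = cyl x \ cover L := by
  induction L, hL using Set.Finite.induction_on with
  | empty =>
    refine ⟨{x}, by simpa using hx, Set.finite_singleton x, ?_, by simp [cover]⟩
    rintro a rfl b rfl hab
    exact absurd rfl hab
  | @insert y L hyL hfin ih =>
    obtain ⟨β, hβA, hβfin, hβ, hβc⟩ := ih fun z hz => hLA (Set.mem_insert_of_mem _ hz)
    -- To remove one more cylinder, each piece of the partition obtained so far is split separately.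
    have hstep : ∀ b ∈ β, ∃ γ ⊆ A, γ.Finite ∧ NonOverlapping γ ∧ cover γ = cyl b ∩ (cyl y)ᶜ := by
      intro b hb
      obtain ⟨α, hαA, hα, hαc⟩ := hA₂ b (hβA hb) y (hLA (Set.mem_insert _ _))
      obtain ⟨γ, hγ, hγfin, hγc⟩ := exists_finite_subcover hαc
      exact ⟨γ, hγ.trans hαA, hγfin, fun s hs t ht => hα s (hγ hs) t (hγ ht), hγc⟩
    choose! γ hγA hγfin hγ hγc using hstep
    refine ⟨⋃ b ∈ β, γ b, Set.iUnion₂_subset hγA, hβfin.biUnion hγfin, ?_, ?_⟩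
    · intro s hs t ht hst
      obtain ⟨b, hb, hs⟩ := Set.mem_iUnion₂.1 hs
      obtain ⟨c, hc, ht⟩ := Set.mem_iUnion₂.1 ht
      by_cases hbc : b = c
      · subst hbc
        exact hγ b hb s hs t ht hst
      · refine Set.subset_empty_iff.1 ((Set.inter_subset_inter ?_ ?_).trans (hβ b hb c hc hbc).le)
        · exact ((cyl_subset_cover hs).trans (hγc b hb).le).trans Set.inter_subset_left
        · exact ((cyl_subset_cover ht).trans (hγc c hc).le).trans Set.inter_subset_left
    · have h1 : cover (⋃ b ∈ β, γ b) = ⋃ b ∈ β, cover (γ b) := by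
        simp only [cover, Set.biUnion_iUnion]
      have h2 : cover (insert y L) = cyl y ∪ cover L := by simp [cover]
      rw [h1, Set.iUnion₂_congr hγc, ← Set.iUnion₂_inter, h2, Set.union_comm, ← Set.sdiff_sdiff, ← hβc]
      rfl

/-- All words of a given length. -/
def allWords : ℕ → List Word
  | 0 => [[]]
  | n + 1 => (allWords n).map (List.cons false) ++ (allWords n).map (List.cons true)

theorem mem_allWords {n : ℕ} {s : Word} : s ∈ allWords n ↔ s.length = n := by
  induction n generalizing s with
  | zero => simp [allWords]
  | succ n ih =>
    cases s with
    | nil => simp [allWords]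
    | cons b s => cases b <;> simp [allWords, ih]

theorem computable_allWords : Computable allWords := by
  refine (Primrec.nat_rec₁ (f := fun _ (l : List Word) =>
    l.map (List.cons false) ++ l.map (List.cons true)) [[]] ?_).to_comp.of_eq fun n => ?_
  · exact Primrec.list_append.comp
      (Primrec.list_map Primrec.snd (Primrec.list_cons.comp (Primrec.const _) Primrec.snd))
      (Primrec.list_map Primrec.snd (Primrec.list_cons.comp (Primrec.const _) Primrec.snd))
  · induction n with
    | zero => rfl
    | succ n ih => simp only [allWords, ← ih]

/-- The first `n` terms of a sequence. -/
def initial (w : Cantor) (n : ℕ) : Word := (List.range n).map w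

theorem exists_append_le {s : Word} {w : Cantor} (h : Str.word s ≤ Str.seq w) (n : ℕ) :
    ∃ a : Word, a.length = n ∧ Str.word (s ++ a) ≤ Str.seq w := by
  refine ⟨initial (fun i => w (s.length + i)) n, by simp [initial], fun i hi => ?_⟩
  rw [List.getElem_append]
  split
  · exact h i _
  · simp [initial, Nat.add_sub_cancel' (not_lt.1 ‹_›)]

/-- An item is a pair of words with an index. -/
abbrev Item := ℕ × Word × Word

/-- The pairs of words with index `n` in a list of items. -/
def fiber (Z : List Item) (n : ℕ) : Set (Word × Word) := {x | (n, x) ∈ Z}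

/-- When `N` bounds the lengths of all listed words, membership in the listed cylinders is decided
by `N` further bits in each coordinate. Thus an inclusion between infinite sets has a finite
certificate. -/
theorem cyl_subset_cover_fiber_iff {v : Item} {Z : List Item} :
    cyl v.2 ⊆ cover (fiber Z v.1) ↔ ∃ N, ∀ a ∈ allWords N, ∀ b ∈ allWords N,
      ∃ z, z ∈ Z ∧ z.1 = v.1 ∧ ofWords z.2 ≤ ofWords (v.2.1 ++ a, v.2.2 ++ b) := by
  constructor
  · intro h
    obtain ⟨N, hN⟩ : ∃ N, ∀ z ∈ Z, z.2.1.length ≤ N ∧ z.2.2.length ≤ N := by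
      clear h
      induction Z with
      | nil => simp
      | cons z Z ih =>
        obtain ⟨N, hN⟩ := ih
        refine ⟨N + z.2.1.length + z.2.2.length, fun y hy => ?_⟩
        rcases List.mem_cons.1 hy with rfl | hy
        · omega
        · have := hN y hy
          omega
    refine ⟨N, fun a ha b hb => ?_⟩
    rw [mem_allWords] at ha hb
    have hmem : (zeroExt (v.2.1 ++ a), zeroExt (v.2.2 ++ b)) ∈ cyl v.2 :=
      ⟨le_trans (b := Str.word _) (List.prefix_append _ _) (le_zeroExt _),
        le_trans (b := Str.word _) (List.prefix_append _ _) (le_zeroExt _)⟩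
    obtain ⟨x, hx, hxw⟩ := mem_cover.1 (h hmem)
    refine ⟨(v.1, x), hx, rfl, ?_⟩
    have hlen := hN _ hx
    simp only at hlen
    constructor
    · rcases word_total hxw.1 (le_zeroExt (v.2.1 ++ a)) with h | h
      · exact h
      · have := h.length_le
        rw [List.length_append] at this
        refine (h.eq_of_length ?_) ▸ List.prefix_rfl
        rw [List.length_append]
        omega
    · rcases word_total hxw.2 (le_zeroExt (v.2.2 ++ b)) with h | h
      · exact h
      · have := h.length_le
        rw [List.length_append] at this
        refine (h.eq_of_length ?_) ▸ List.prefix_rfl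
        rw [List.length_append]
        omega
  · rintro ⟨N, hN⟩ w hw
    obtain ⟨a, ha, haw⟩ := exists_append_le hw.1 N
    obtain ⟨b, hb, hbw⟩ := exists_append_le hw.2 N
    obtain ⟨z, hz, hzv, hle⟩ := hN a (mem_allWords.2 ha) b (mem_allWords.2 hb)
    refine mem_cover.2 ⟨z.2, ?_, hle.trans ⟨haw, hbw⟩⟩
    rw [← hzv]
    exact hz

theorem rePred_mem_list {α β : Type} [Primcodable α] [Primcodable β] {f : α → β}
    {l : α → List β} (hf : Computable f) (hl : Computable l) : REPred fun a => f a ∈ l a := by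
  simp_rw [List.mem_iff_getElem?]
  exact rePred_exists (rePred_eq (by fun_prop) (by fun_prop))

theorem rePred_cyl_subset_cover_fiber {α : Type} [Primcodable α] {f : α → Item}
    {l : α → List Item} (hf : Computable f) (hl : Computable l) :
    REPred fun a => cyl (f a).2 ⊆ cover (fiber (l a) (f a).1) := by
  simp_rw [cyl_subset_cover_fiber_iff]
  refine rePred_exists (rePred_forall_mem_list (rePred_forall_mem_list (rePred_exists ?_) ?_) ?_)
  · exact (rePred_mem_list (by fun_prop) (by fun_prop)).and
      ((rePred_eq (by fun_prop) (by fun_prop)).and (rePred_ofWords_le (by fun_prop) (by fun_prop)))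
  · exact computable_allWords.comp (by fun_prop)
  · exact computable_allWords.comp (by fun_prop)

theorem rePred_not_compatible {α : Type} [Primcodable α] {f g : α → Word × Word}
    (hf : Computable f) (hg : Computable g) : REPred fun a => ¬ Compatible (f a) (g a) := by
  have h1 : PrimrecPred fun x : Word × Word => x.1 <+: x.2 ∨ x.2 <+: x.1 :=
    PrimrecPred.or (primrecRel_prefix.comp Primrec.fst Primrec.snd)
      (primrecRel_prefix.comp Primrec.snd Primrec.fst)
  have h2 : PrimrecPred fun x : (Word × Word) × (Word × Word) => ¬ Compatible x.1 x.2 :=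
    PrimrecPred.not (PrimrecPred.and
      (h1.comp ((Primrec.fst.comp Primrec.fst).pair (Primrec.fst.comp Primrec.snd)))
      (h1.comp ((Primrec.snd.comp Primrec.fst).pair (Primrec.snd.comp Primrec.snd))))
  exact rePred_rel (R := fun x y => ¬ Compatible x y) h2.primrecRel hf hg

/-- Items with the same index have disjoint cylinders. -/
def Apart (a b : Item) : Prop := a.1 = b.1 → ¬ Compatible a.2 b.2

theorem rePred_pairwise_apart {α : Type} [Primcodable α] {l : α → List Item}
    (hl : Computable l) : REPred fun a => (l a).Pairwise Apart := by
  -- The implication in `Apart` is restated as a disjunction, with unequal indices expressed by `<`,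
  -- so that every part is r.e.
  refine (rePred_forall_mem_list (p := fun a j => ∀ i ∈ List.range j, ∃ v : Item × Item,
    (l a)[i]? = some v.1 ∧ (l a)[j]? = some v.2 ∧
      ((v.1.1 < v.2.1 ∨ v.2.1 < v.1.1) ∨ ¬ Compatible v.1.2 v.2.2))
    (l := fun a => List.range (l a).length) ?_ (by fun_prop)).of_eq fun a => ?_
  · refine rePred_forall_mem_list (rePred_exists ?_) (by fun_prop)
    refine (rePred_eq (by fun_prop) (by fun_prop)).and ((rePred_eq (by fun_prop) (by fun_prop)).and
      (((rePred_lt (by fun_prop) (by fun_prop)).or (rePred_lt (by fun_prop) (by fun_prop))).or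
        (rePred_not_compatible (by fun_prop) (by fun_prop))))
  · rw [List.pairwise_iff_getElem]
    constructor
    · intro h i j hi hj hij
      obtain ⟨⟨v, v'⟩, h1, h2, h3⟩ := h j (List.mem_range.2 hj) i (List.mem_range.2 hij)
      rw [List.getElem?_eq_getElem hi, Option.some.injEq] at h1
      rw [List.getElem?_eq_getElem hj, Option.some.injEq] at h2
      rw [h1, h2]
      intro hv
      rcases h3 with h3 | h3
      · simp only at h3 hv
        omega
      · exact h3
    · intro h j hj i hij
      rw [List.mem_range] at hj hij
      refine ⟨((l a)[i], (l a)[j]), List.getElem?_eq_getElem _, List.getElem?_eq_getElem _, ?_⟩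
      have := h i j (hij.trans hj) hj hij
      by_cases he : (l a)[i].1 = (l a)[j].1
      · exact Or.inr (this he)
      · exact Or.inl (lt_or_gt_of_ne he)

/-- Lists of items in `V` with disjoint cylinders for each index. -/
def IsPacking (V : Item → Prop) (Z : List Item) : Prop := (∀ v ∈ Z, V v) ∧ Z.Pairwise Apart

/-- The part of `cyl v.2` not yet covered at index `v.1` is a finite disjoint union of cylinders of
`A`. These elements extend `v.2`, so upward closure keeps them in `V`, and they can be appended. -/
theorem IsPacking.exists_extension {A : Set (Word × Word)} (hA₂ : PartitionCondition₂ A)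
    {V : Item → Prop} (hVA : ∀ v, V v → v.2 ∈ A)
    (hVup : ∀ n x y, V (n, x) → y ∈ A → ofWords x ≤ ofWords y → V (n, y)) {Z : List Item}
    (hZ : IsPacking V Z) {v : Item} (hv : V v) :
    ∃ Z', Z <+: Z' ∧ IsPacking V Z' ∧ cyl v.2 ⊆ cover (fiber Z' v.1) := by
  have hfib : (fiber Z v.1).Finite :=
    (List.finite_toSet (Z.map Prod.snd)).subset fun x hx => List.mem_map.2 ⟨_, hx, rfl⟩
  obtain ⟨β, hβA, hβfin, hβ, hβc⟩ := exists_finite_partition_sdiff hA₂ (hVA v hv) hfib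
    fun x hx => hVA _ (hZ.1 _ hx)
  have hmem : ∀ x, x ∈ hβfin.toFinset.toList ↔ x ∈ β := by simp
  have hsub : ∀ x ∈ β, cyl x ⊆ cyl v.2 \ cover (fiber Z v.1) := fun x hx =>
    (cyl_subset_cover hx).trans hβc.le
  refine ⟨Z ++ hβfin.toFinset.toList.map fun x => (v.1, x), List.prefix_append _ _, ⟨?_, ?_⟩, ?_⟩
  · intro z hz
    rcases List.mem_append.1 hz with hz | hz
    · exact hZ.1 z hz
    · obtain ⟨x, hx, rfl⟩ := List.mem_map.1 hz
      rw [hmem] at hx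
      exact hVup v.1 v.2 x hv (hβA hx)
        (ofWords_le_of_cyl_subset ((hsub x hx).trans Set.sdiff_subset))
  · refine List.pairwise_append.2 ⟨hZ.2, ?_, ?_⟩
    · refine List.pairwise_map.2 (List.Pairwise.imp_of_mem ?_ (Finset.nodup_toList _))
      intro x y hx hy hxy _
      exact cyl_inter_eq_empty_iff.1 (hβ x ((hmem x).1 hx) y ((hmem y).1 hy) hxy)
    · intro z hz z' hz' hzz'
      obtain ⟨x, hx, rfl⟩ := List.mem_map.1 hz'
      rw [← disjoint_cyl_iff]
      refine Set.disjoint_of_subset_right (hsub x ((hmem x).1 hx)) ?_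
      refine Set.disjoint_of_subset_left ?_ Set.disjoint_sdiff_right
      exact cyl_subset_cover (show (v.1, z.2) ∈ Z from hzz' ▸ hz)
  · intro w hw
    by_cases hwZ : w ∈ cover (fiber Z v.1)
    · exact cover_mono (fun x hx => List.mem_append_left _ hx) hwZ
    · have hwβ : w ∈ cover β := hβc ▸ ⟨hw, hwZ⟩
      exact cover_mono (fun x hx => List.mem_append_right _
        (List.mem_map.2 ⟨x, (hmem x).2 hx, rfl⟩)) hwβ

/-- An r.e. family of subsets of `A`, closed upwards in `A`, has a computable enumeration of
elements with disjoint cylinders that cover the same sets. -/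
theorem exists_disjoint_enumeration {A : Set (Word × Word)} (hA₂ : PartitionCondition₂ A)
    {V : Item → Prop} (hV : REPred V) (hVA : ∀ v, V v → v.2 ∈ A)
    (hVup : ∀ n x y, V (n, x) → y ∈ A → ofWords x ≤ ofWords y → V (n, y)) :
    ∃ e : ℕ → Option Item, Computable e ∧ (∀ j v, e j = some v → V v) ∧
      (∀ i j v v', e i = some v → e j = some v' → i ≠ j → Apart v v') ∧
      ∀ v, V v → cyl v.2 ⊆ cover {x | ∃ j, e j = some (v.1, x)} := by
  obtain ⟨g, hg, hgV⟩ := exists_enumeration hV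
  -- One stage: prolong the list to a packing that covers the `t`-th enumerated item of `V`. Since
  -- `R` is r.e., the stages can be chosen computably.
  let R : ℕ → List Item → List Item → Prop := fun t Z Z' =>
    (∃ L, Z ++ L = Z') ∧ ((∀ v ∈ Z', V v) ∧ Z'.Pairwise Apart) ∧
      (g t = none ∨ ∃ v, g t = some v ∧ cyl v.2 ⊆ cover (fiber Z' v.1))
  have hR : REPred fun x : ℕ × List Item × List Item => R x.1 x.2.1 x.2.2 := by
    refine REPred.and (rePred_exists (rePred_eq (by fun_prop) (by fun_prop))) (REPred.and
      (REPred.and (rePred_forall_mem_list (hV.comp (by fun_prop)) (by fun_prop))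
        (rePred_pairwise_apart (by fun_prop)))
      (REPred.or (rePred_eq (by fun_prop) (by fun_prop)) (rePred_exists (REPred.and
        (rePred_eq (by fun_prop) (by fun_prop))
        (rePred_cyl_subset_cover_fiber (by fun_prop) (by fun_prop))))))
  obtain ⟨Z, hZ, hZ0, hZR⟩ := exists_computable_seq hR (I := IsPacking V) (s₀ := [])
    ⟨by simp, List.Pairwise.nil⟩ (fun t Z hZ => by
      cases hgt : g t with
      | none => exact ⟨Z, ⟨[], by simp⟩, hZ, Or.inl hgt⟩
      | some v =>
        obtain ⟨Z', h1, h2, h3⟩ := hZ.exists_extension hA₂ hVA hVup ((hgV v).2 ⟨t, hgt⟩)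
        exact ⟨Z', h1, h2, Or.inr ⟨v, hgt, h3⟩⟩) (fun t Z Z' _ h => h.2.1)
  have hmono : ∀ s t, s ≤ t → Z s <+: Z t := by
    intro s t hst
    induction t, hst using Nat.le_induction with
    | base => exact List.prefix_rfl
    | succ t _ ih => exact ih.trans (hZR t).2.1
  -- With `j` coding `(t, i)`, the entry at position `i` is output only if it was added at stage
  -- `t`. Hence each position of the growing list is output for exactly one `j`.
  let e : ℕ → Option Item := fun j =>
    bif decide ((Z j.unpair.1).length ≤ j.unpair.2) then (Z (j.unpair.1 + 1))[j.unpair.2]? else none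
  have he_some : ∀ j v, e j = some v ↔
      (Z j.unpair.1).length ≤ j.unpair.2 ∧ (Z (j.unpair.1 + 1))[j.unpair.2]? = some v := by
    intro j v
    by_cases h : (Z j.unpair.1).length ≤ j.unpair.2 <;> simp [e, h]
  have he_get : ∀ j v t, e j = some v → j.unpair.1 + 1 ≤ t → (Z t)[j.unpair.2]? = some v := by
    intro j v t hj ht
    obtain ⟨L, hL⟩ := hmono _ _ ht
    have h := ((he_some j v).1 hj).2
    obtain ⟨hl, -⟩ := List.getElem?_eq_some_iff.1 h
    rw [← hL, List.getElem?_append_left hl, h]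
  refine ⟨e, ?_, ?_, ?_, ?_⟩
  · refine Computable.cond ?_ (by fun_prop) (by fun_prop)
    exact (primrecRel_iff_primrec_decide.1 Primrec.nat_le).to_comp.comp (by fun_prop) (by fun_prop)
  · intro j v hj
    exact (hZR (j.unpair.1 + 1)).1.1 v (List.mem_of_getElem? ((he_some j v).1 hj).2)
  · have key : ∀ i j v v', e i = some v → e j = some v' → i.unpair.2 < j.unpair.2 →
        Apart v v' := by
      intro i j v v' hi hj hij
      have h1 := he_get i v _ hi (le_max_left _ (j.unpair.1 + 1))
      have h2 := he_get j v' _ hj (le_max_right (i.unpair.1 + 1) _)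
      obtain ⟨hil, h1⟩ := List.getElem?_eq_some_iff.1 h1
      obtain ⟨hjl, h2⟩ := List.getElem?_eq_some_iff.1 h2
      have := List.pairwise_iff_getElem.1 (hZR _).1.2 _ _ hil hjl hij
      rwa [h1, h2] at this
    have key' : ∀ i j v v', e i = some v → e j = some v' → i.unpair.2 = j.unpair.2 →
        ¬ i.unpair.1 < j.unpair.1 := by
      intro i j v v' hi hj h2 h1
      obtain ⟨hl, -⟩ := List.getElem?_eq_some_iff.1 ((he_some i v).1 hi).2
      have hle := (hmono (i.unpair.1 + 1) j.unpair.1 h1).length_le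
      have := ((he_some j v').1 hj).1
      omega
    intro i j v v' hi hj hij
    rcases lt_trichotomy i.unpair.2 j.unpair.2 with h | h | h
    · exact key i j v v' hi hj h
    · refine absurd ?_ hij
      have h1 := key' i j v v' hi hj h
      have h2 := key' j i v' v hj hi h.symm
      rw [← Nat.pair_unpair i, ← Nat.pair_unpair j, h, le_antisymm (not_lt.1 h2) (not_lt.1 h1)]
    · intro hv hc
      exact key j i v' v hj hi h hv.symm ⟨hc.1.symm, hc.2.symm⟩
  · intro v hv
    obtain ⟨t, ht⟩ := (hgV v).1 hv
    rcases (hZR t).2.2.2 with h | ⟨v', hv', hc⟩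
    · simp [ht] at h
    · obtain rfl : v = v' := Option.some.inj (ht.symm.trans hv')
      refine hc.trans (cover_mono fun x hx => ?_)
      have hfirst : ∀ T, (v.1, x) ∈ Z T → ∃ j, e j = some (v.1, x) := by
        intro T
        induction T with
        | zero => simp [hZ0]
        | succ T ih =>
          intro hmem
          obtain ⟨i, hi⟩ := List.mem_iff_getElem?.1 hmem
          by_cases hlen : (Z T).length ≤ i
          · exact ⟨Nat.pair T i, (he_some _ _).2 (by simpa using ⟨hlen, hi⟩)⟩
          · refine ih ?_
            obtain ⟨L, hL⟩ := (hZR T).2.1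
            rw [← hL, List.getElem?_append_left (not_le.1 hlen)] at hi
            exact List.mem_of_getElem? hi
      exact hfirst _ hx

/-! ### Interval codes -/

/-- The number with given binary digits. -/
def codeVal (c : Word) : ℕ := c.foldl (fun v b => 2 * v + b.toNat) 0

theorem codeVal_append_singleton (c : Word) (b : Bool) :
    codeVal (c ++ [b]) = 2 * codeVal c + b.toNat := by
  simp [codeVal]

@[fun_prop]
theorem computable_codeVal {α : Type} [Primcodable α] {f : α → Word} (hf : Computable f) :
    Computable fun a => codeVal (f a) := by
  have h : Primrec codeVal := by
    refine Primrec.list_foldl (f := fun c : Word => c) (g := fun _ => 0)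
      (h := fun _ x => 2 * x.1 + x.2.toNat) Primrec.id (Primrec.const 0) ?_
    exact Primrec.nat_add.comp
      (Primrec.nat_mul.comp (Primrec.const 2) (Primrec.fst.comp Primrec.snd))
      ((Primrec.dom_bool Bool.toNat).comp (Primrec.snd.comp Primrec.snd))
  exact h.to_comp.comp hf

/-- The left endpoint of the dyadic interval with a given code. -/
noncomputable def lo (c : Word) : ℝ := (codeVal c : ℝ) / 2 ^ c.length

/-- The right endpoint of the dyadic interval with a given code. -/
noncomputable def hi (c : Word) : ℝ := ((codeVal c : ℝ) + 1) / 2 ^ c.length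

theorem lo_lt_hi (c : Word) : lo c < hi c := by
  unfold lo hi
  gcongr
  linarith

theorem lo_hi_append (c d : Word) : lo c ≤ lo (c ++ d) ∧ hi (c ++ d) ≤ hi c := by
  induction d using List.reverseRecOn with
  | nil => simp
  | append_singleton d b ih =>
    rw [← List.append_assoc]
    generalize c ++ d = r at ih
    have hb : (0 : ℝ) ≤ b.toNat ∧ (b.toNat : ℝ) ≤ 1 := by cases b <;> simp
    have h1 : lo r ≤ lo (r ++ [b]) := by
      unfold lo
      rw [codeVal_append_singleton, List.length_append, List.length_singleton, pow_succ,
        div_le_div_iff₀ (by positivity) (by positivity)]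
      push_cast
      have : (0 : ℝ) < 2 ^ r.length := by positivity
      nlinarith
    have h2 : hi (r ++ [b]) ≤ hi r := by
      unfold hi
      rw [codeVal_append_singleton, List.length_append, List.length_singleton, pow_succ,
        div_le_div_iff₀ (by positivity) (by positivity)]
      push_cast
      have : (0 : ℝ) < 2 ^ r.length := by positivity
      nlinarith
    exact ⟨ih.1.trans h1, h2.trans ih.2⟩

theorem lo_lt_hi_of_comparable {c d : Word} (h : c <+: d ∨ d <+: c) : lo c < hi d := by
  rcases h with ⟨r, rfl⟩ | ⟨r, rfl⟩
  · exact (lo_hi_append c r).1.trans_lt (lo_lt_hi _)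
  · exact (lo_lt_hi _).trans_le (lo_hi_append d r).2

theorem exists_codeVal_eq (n v : ℕ) (h : v < 2 ^ n) : ∃ c : Word, c.length = n ∧ codeVal c = v := by
  induction n generalizing v with
  | zero => exact ⟨[], rfl, by simp [codeVal]; omega⟩
  | succ n ih =>
    obtain ⟨c, hc, hcv⟩ := ih (v / 2) (by omega)
    refine ⟨c ++ [decide (v % 2 = 1)], by simp [hc], ?_⟩
    rw [codeVal_append_singleton, hcv]
    rcases Nat.mod_two_eq_zero_or_one v with h | h <;> simp [h] <;> omega

/-- Every interval contains a dyadic interval of comparable length. -/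
theorem exists_code {a b : ℝ} (ha : 0 ≤ a) (hab : a < b) (hb : b ≤ 1) :
    ∃ c : Word, a ≤ lo c ∧ hi c ≤ b ∧ b - a ≤ 4 * (2⁻¹ : ℝ) ^ c.length := by
  -- The length `b - a` lies between `2⁻¹ ^ (n + 1)` and `2⁻¹ ^ n`. On the grid of mesh `2⁻¹ ^ (n +
  -- 2)` it spans at least two cells, so the cell that starts at the first grid point from `a` on
  -- fits. The two extra bits cause the factor `4`.
  obtain ⟨n, hn1, hn2⟩ := exists_nat_pow_near_of_lt_one (x := b - a) (y := 2⁻¹) (by linarith)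
    (by linarith) (by norm_num) (by norm_num)
  have hpow : (0 : ℝ) < 2 ^ (n + 2) := by positivity
  have hlow : 2 ≤ (b - a) * 2 ^ (n + 2) := by
    have h1 : (2⁻¹ : ℝ) ^ (n + 1) * 2 ^ (n + 2) = 2 := by
      rw [pow_succ 2 (n + 1), ← mul_assoc, ← mul_pow]
      norm_num
    exact h1.symm.le.trans (mul_le_mul_of_nonneg_right hn1.le hpow.le)
  have hceil := Nat.ceil_lt_add_one (a := a * 2 ^ (n + 2)) (by positivity)
  have hceil' := Nat.le_ceil (a * 2 ^ (n + 2))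
  generalize ⌈a * 2 ^ (n + 2)⌉₊ = v at *
  have hle : (v : ℝ) + 1 ≤ b * 2 ^ (n + 2) := by linarith
  have hlt : v < 2 ^ (n + 2) := by
    have : (v : ℝ) < 2 ^ (n + 2) := by nlinarith
    exact_mod_cast this
  obtain ⟨c, hc, hcv⟩ := exists_codeVal_eq _ v hlt
  refine ⟨c, ?_, ?_, ?_⟩
  · rw [lo, hc, hcv, le_div_iff₀ hpow]
    exact hceil'
  · rw [hi, hc, hcv, div_le_iff₀ hpow]
    exact hle
  · rw [hc, pow_add]
    norm_num at hn2 ⊢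
    linarith

/-! ### Machines from interval assignments -/

/-- The rational number given by a numerator and a denominator. -/
noncomputable def ratVal (s : ℕ × ℕ) : ℝ := (s.1 : ℝ) / s.2

/-- The relation that maps the codes of intervals inside `[s j, s (j + 1))` to the `j`-th item. -/
def intervalRel (e : ℕ → Option Item) (s : ℕ → ℕ × ℕ) : Set ((Word × Word) × (Word × Word)) :=
  {z | z.2 = ([], []) ∨ ∃ y : ℕ × ℕ, e y.1 = some (y.2, z.2) ∧
    -- The comparisons of endpoints are cleared of denominators to be decidable in `ℕ`. The second
    -- program component is never read.
    (s y.1).1 * 2 ^ z.1.1.length ≤ codeVal z.1.1 * (s y.1).2 ∧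
    (codeVal z.1.1 + 1) * (s (y.1 + 1)).2 ≤ (s (y.1 + 1)).1 * 2 ^ z.1.1.length}

theorem rePred_intervalRel {e : ℕ → Option Item} {s : ℕ → ℕ × ℕ} (he : Computable e)
    (hs : Computable s) : REPred fun z => z ∈ intervalRel e s := by
  refine REPred.or (rePred_eq (by fun_prop) (by fun_prop)) (rePred_exists ?_)
  exact (rePred_eq (by fun_prop) (by fun_prop)).and ((rePred_le (by fun_prop) (by fun_prop)).and
    (rePred_le (by fun_prop) (by fun_prop)))

theorem mem_intervalRel_iff {e : ℕ → Option Item} {s : ℕ → ℕ × ℕ} (hs : ∀ j, 0 < (s j).2)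
    {z : (Word × Word) × (Word × Word)} :
    z ∈ intervalRel e s ↔ z.2 = ([], []) ∨ ∃ j n, e j = some (n, z.2) ∧
      ratVal (s j) ≤ lo z.1.1 ∧ hi z.1.1 ≤ ratVal (s (j + 1)) := by
  have h1 : ∀ j, (s j).1 * 2 ^ z.1.1.length ≤ codeVal z.1.1 * (s j).2 ↔
      ratVal (s j) ≤ lo z.1.1 := by
    intro j
    have : (0 : ℝ) < (s j).2 := by exact_mod_cast hs j
    rw [ratVal, lo, div_le_div_iff₀ this (by positivity)]
    exact_mod_cast Iff.rfl
  have h2 : ∀ j, (codeVal z.1.1 + 1) * (s j).2 ≤ (s j).1 * 2 ^ z.1.1.length ↔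
      hi z.1.1 ≤ ratVal (s j) := by
    intro j
    have : (0 : ℝ) < (s j).2 := by exact_mod_cast hs j
    rw [ratVal, hi, div_le_div_iff₀ (by positivity) this]
    exact_mod_cast Iff.rfl
  simp only [intervalRel, Set.mem_ofPred_eq, Prod.exists, h1, h2]

/-- Comparable codes have nested, hence overlapping, dyadic intervals, whereas different `j` have
subintervals without common interior. So a program prints at most one nontrivial pair, which makes
the suprema exist. -/
theorem intervalRel_unique {e : ℕ → Option Item} {s : ℕ → ℕ × ℕ} (hs : ∀ j, 0 < (s j).2)
    (hmono : Monotone fun j => ratVal (s j)) {p q x y : Word × Word}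
    (hx : (p, x) ∈ intervalRel e s) (hy : (q, y) ∈ intervalRel e s)
    (hpq : p.1 <+: q.1 ∨ q.1 <+: p.1) (hx0 : x ≠ ([], [])) (hy0 : y ≠ ([], [])) : x = y := by
  obtain ⟨j, n, hj, hj1, hj2⟩ := ((mem_intervalRel_iff hs).1 hx).resolve_left hx0
  obtain ⟨i, m, hi, hi1, hi2⟩ := ((mem_intervalRel_iff hs).1 hy).resolve_left hy0
  have h1 := lo_lt_hi_of_comparable hpq
  have h2 := lo_lt_hi_of_comparable hpq.symm
  rcases lt_trichotomy i j with h | h | h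
  · have := hmono (show i + 1 ≤ j from h)
    simp only at this hj1 hi2
    linarith
  · subst h
    have := hi.symm.trans hj
    simp only [Option.some.injEq, Prod.mk.injEq] at this
    exact this.2.symm
  · have := hmono (show j + 1 ≤ i from h)
    simp only at this hj2 hi1
    linarith

theorem exists_isLUB_intervalRel {e : ℕ → Option Item} {s : ℕ → ℕ × ℕ} (hs : ∀ j, 0 < (s j).2)
    (hmono : Monotone fun j => ratVal (s j)) (p : Str × Str) :
    ∃ z, IsLUB (below (intervalRel e s) p) z := by
  by_cases h : ∃ q x, (q, x) ∈ intervalRel e s ∧ ofWords q ≤ p ∧ x ≠ ([], [])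
  · obtain ⟨q, x, hx, hq, hx0⟩ := h
    refine ⟨ofWords x, ?_, fun b hb => hb ⟨q, x, hx, hq, rfl⟩⟩
    rintro _ ⟨q', y, hy, hq', rfl⟩
    by_cases hy0 : y = ([], [])
    · exact hy0 ▸ ofWords_nil_le _
    · rw [intervalRel_unique hs hmono hx hy (word_total hq.1 hq'.1) hx0 hy0]
  · push Not at h
    refine ⟨ofWords ([], []), ?_, fun b _ => ofWords_nil_le b⟩
    rintro _ ⟨q', y, hy, hq', rfl⟩
    rw [h q' y hy hq']

/-- A computable sequence of intervals assigned to items yields a computable monotone function. -/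
theorem exists_machine {e : ℕ → Option Item} {s : ℕ → ℕ × ℕ} (he : Computable e)
    (hsc : Computable s) (hs : ∀ j, 0 < (s j).2) (hmono : Monotone fun j => ratVal (s j))
    (hle : ∀ j, ratVal (s j) ≤ 1) :
    ∃ F f, (REPred fun z => z ∈ F) ∧ MonotoneCondition F ∧ IsDefinedBy F f ∧
      ∀ j n x, e j = some (n, x) → ratVal (s j) < ratVal (s (j + 1)) → ∃ l : ℕ,
        Km f (ofWords x) ≤ l ∧ ratVal (s (j + 1)) - ratVal (s j) ≤ 4 * (2⁻¹ : ℝ) ^ l := by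
  choose f hf using exists_isLUB_intervalRel (e := e) hs hmono
  refine ⟨intervalRel e s, f, rePred_intervalRel he hsc, fun p => ⟨Or.inl rfl, ?_⟩, hf, ?_⟩
  · exact exists_isLUB_intervalRel hs hmono _
  · intro j n x hj hlt
    obtain ⟨c, hc1, hc2, hc3⟩ := exists_code (by unfold ratVal; positivity) hlt (hle _)
    refine ⟨c.length, iInf₂_le (Str.word c) ?_, hc3⟩
    exact (hf _).1 ⟨(c, []), x, (mem_intervalRel_iff hs).2 (Or.inr ⟨j, n, hj, hc1, hc2⟩),
      le_rfl, rfl⟩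

/-! ### Points that are not random have unbounded deficiency -/

/-- The prefixes of `w` in `A` form a chain, since their cylinders share `w`. Each coordinate of `x`
is reached by some member, and the larger of the two reaches both. -/
theorem exists_mem_prefixesIn_ge {A : Set (Word × Word)} (hA₁ : PartitionCondition₁ A)
    {w : Cantor × Cantor} (hw : IsLUB (ofWords '' prefixesIn A w) (ofSeqs w)) {x : Word × Word}
    (hx : ofWords x ≤ ofSeqs w) : ∃ y ∈ prefixesIn A w, ofWords x ≤ ofWords y := by
  have h := isLUB_prod.1 hw
  obtain ⟨y₀, hy₀⟩ : (prefixesIn A w).Nonempty := by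
    have h0 : Str.word [w.1 0] ≤ (ofSeqs w).1 := by
      intro i hi
      obtain rfl : i = 0 := by simpa using hi
      rfl
    rcases exists_le_of_isLUB h.1 h0 with h | ⟨_, ⟨_, ⟨y, hy, rfl⟩, rfl⟩, -⟩
    · simp at h
    · exact ⟨y, hy⟩
  obtain ⟨y, hy, hxy⟩ : ∃ y ∈ prefixesIn A w, x.1 <+: y.1 := by
    rcases exists_le_of_isLUB h.1 hx.1 with h | ⟨_, ⟨_, ⟨y, hy, rfl⟩, rfl⟩, hxy⟩
    · exact ⟨y₀, hy₀, h ▸ List.nil_prefix⟩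
    · exact ⟨y, hy, hxy⟩
  obtain ⟨z, hz, hxz⟩ : ∃ z ∈ prefixesIn A w, x.2 <+: z.2 := by
    rcases exists_le_of_isLUB h.2 hx.2 with h | ⟨_, ⟨_, ⟨y, hy, rfl⟩, rfl⟩, hxy⟩
    · exact ⟨y₀, hy₀, h ▸ List.nil_prefix⟩
    · exact ⟨y, hy, hxy⟩
  rcases hA₁ y hy.1 z hz.1 with h | h | h
  · exact ⟨z, hz, hxy.trans h.1, hxz⟩
  · exact ⟨y, hy, hxy, hxz.trans h.2⟩
  · exact absurd (show w ∈ cyl y ∩ cyl z from ⟨hy.2, hz.2⟩) (h ▸ Set.notMem_empty w)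

/-- The scaled measure `2 ^ n * P (Δ x)` of an item `(n, x)`. -/
noncomputable def weight (P : Measure (Cantor × Cantor)) : Option Item → ℝ≥0∞
  | none => 0
  | some v => 2 ^ v.1 * P (cyl v.2)

/-- At a fixed index `n` the cylinders are disjoint, so their weights total at most `2 ^ n * 2⁻¹ ^
(2 * n + 2) = 2⁻¹ ^ (n + 2)`; the sum over `n` is `1/2`. -/
theorem tsum_weight_le {P : Measure (Cantor × Cantor)} {e : ℕ → Option Item}
    (hapart : ∀ i j v v', e i = some v → e j = some v' → i ≠ j → Apart v v')
    (hsmall : ∀ n, P (cover {x | ∃ j, e j = some (n, x)}) ≤ (2⁻¹ : ℝ≥0∞) ^ (2 * n + 2)) :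
    ∑' j, weight P (e j) ≤ 2⁻¹ := by
  -- `B n j` is empty unless the `j`-th item has index `n`. This writes the sum of weights as a
  -- double sum, whose order can be exchanged.
  let B : ℕ → ℕ → Set (Cantor × Cantor) := fun n j => {w | ∃ x, e j = some (n, x) ∧ w ∈ cyl x}
  have hB_some : ∀ n j x, e j = some (n, x) → B n j = cyl x := by
    intro n j x hj
    refine Set.ext fun w => ⟨fun ⟨y, hy, hwy⟩ => ?_, fun h => ⟨x, hj, h⟩⟩
    rw [(Prod.mk.inj (Option.some.inj (hj.symm.trans hy))).2]
    exact hwy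
  have hB_empty : ∀ n j, (∀ x, e j ≠ some (n, x)) → B n j = ∅ :=
    fun n j h => Set.eq_empty_of_forall_notMem fun w ⟨x, hx, _⟩ => h x hx
  have hB_meas : ∀ n j, MeasurableSet (B n j) := by
    intro n j
    by_cases h : ∃ x, e j = some (n, x)
    · obtain ⟨x, hx⟩ := h
      rw [hB_some n j x hx]
      exact measurableSet_cyl x
    · rw [hB_empty n j (not_exists.1 h)]
      exact MeasurableSet.empty
  have hweight : ∀ j, weight P (e j) = ∑' n, 2 ^ n * P (B n j) := by
    intro j
    rcases hj : e j with _ | ⟨m, x⟩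
    · have : ∀ n, B n j = ∅ := fun n => hB_empty n j (by simp [hj])
      simp [weight, this]
    · rw [tsum_eq_single m, hB_some m j x hj, weight]
      intro n hn
      rw [hB_empty n j fun y hy => hn ?_]
      · simp
      · rw [hj] at hy
        simp only [Option.some.injEq, Prod.mk.injEq] at hy
        exact hy.1.symm
  have hB_disj : ∀ n, Pairwise (Function.onFun Disjoint (B n)) := by
    intro n i j hij
    refine Set.disjoint_left.2 ?_
    rintro w ⟨x, hx, hwx⟩ ⟨y, hy, hwy⟩
    exact hapart i j _ _ hx hy hij rfl (compatible_of_le hwx hwy)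
  have hB_union : ∀ n, (⋃ j, B n j) ⊆ cover {x | ∃ j, e j = some (n, x)} := by
    intro n w hw
    obtain ⟨j, x, hx, hwx⟩ := Set.mem_iUnion.1 hw
    exact mem_cover.2 ⟨x, ⟨j, hx⟩, hwx⟩
  calc ∑' j, weight P (e j) = ∑' n, ∑' j, 2 ^ n * P (B n j) := by
        simp_rw [hweight]
        exact ENNReal.tsum_comm
    _ = ∑' n, 2 ^ n * P (⋃ j, B n j) := by
        refine tsum_congr fun n => ?_
        rw [ENNReal.tsum_mul_left, measure_iUnion (hB_disj n) (hB_meas n)]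
    _ ≤ ∑' n : ℕ, (2⁻¹ : ℝ≥0∞) ^ (n + 1) * 2⁻¹ := by
        refine ENNReal.tsum_le_tsum fun n => ?_
        calc 2 ^ n * P (⋃ j, B n j) ≤ 2 ^ n * (2⁻¹ : ℝ≥0∞) ^ (2 * n + 2) := by
              gcongr
              exact (measure_mono (hB_union n)).trans (hsmall n)
          _ = (2 * 2⁻¹) ^ n * ((2⁻¹ : ℝ≥0∞) ^ (n + 1) * 2⁻¹) := by ring
          _ = (2⁻¹ : ℝ≥0∞) ^ (n + 1) * 2⁻¹ := by
              rw [ENNReal.mul_inv_cancel (by simp) (by simp), one_pow, one_mul]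
    _ = 2⁻¹ := by
        rw [ENNReal.tsum_mul_right, ENNReal.tsum_geometric_add_one, ENNReal.one_sub_inv_two, inv_inv,
          ENNReal.inv_mul_cancel (by simp) (by simp), one_mul]

/-- The endpoints are partial sums of strict upper approximations of the weights. Strictness gives
positive length even to items of measure zero. -/
theorem exists_intervals {P : Measure (Cantor × Cantor)} [IsProbabilityMeasure P]
    (hP : IsComputableProb P) {e : ℕ → Option Item} (he : Computable e)
    (hsum : ∑' j, weight P (e j) ≤ 2⁻¹) :
    ∃ s : ℕ → ℕ × ℕ, Computable s ∧ (∀ j, 0 < (s j).2) ∧ (Monotone fun j => ratVal (s j)) ∧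
      (∀ j, ratVal (s j) ≤ 1) ∧ ∀ j n x, e j = some (n, x) →
        2 ^ n * P.real (cyl x) < ratVal (s (j + 1)) - ratVal (s j) := by
  obtain ⟨a, b, ha, hb, hab⟩ := hP.exists_upper
  -- The precision `v.1 + z.1 + 2` keeps the error at step `j` below `2⁻¹ ^ (j + 2)` after scaling
  -- by `2 ^ v.1`. All errors total at most `1/2`, which with the weights stays within `1`.
  let step : ℕ × (ℕ × ℕ) → ℕ × ℕ := fun z => Option.casesOn (e z.1) z.2 fun v =>
    (z.2.1 * b (v.2, v.1 + z.1 + 2) + 2 ^ v.1 * a (v.2, v.1 + z.1 + 2) * z.2.2,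
      z.2.2 * b (v.2, v.1 + z.1 + 2))
  have hstep : Computable step := by
    refine Computable.option_casesOn (by fun_prop) (by fun_prop) ?_
    change Computable fun x : (ℕ × (ℕ × ℕ)) × Item => _
    fun_prop
  let s : ℕ → ℕ × ℕ := fun j => Nat.rec (0, 1) (fun j s => step (j, s)) j
  have hs_none : ∀ j, e j = none → s (j + 1) = s j := by
    intro j hj
    simp [s, step, hj]
  have hs_some : ∀ j n x, e j = some (n, x) → s (j + 1) =
      ((s j).1 * b (x, n + j + 2) + 2 ^ n * a (x, n + j + 2) * (s j).2,
        (s j).2 * b (x, n + j + 2)) := by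
    intro j n x hj
    simp [s, step, hj]
  have hpos : ∀ j, 0 < (s j).2 := by
    intro j
    induction j with
    | zero => exact Nat.one_pos
    | succ j ih =>
      rcases hj : e j with _ | ⟨n, x⟩
      · rwa [hs_none j hj]
      · rw [hs_some j n x hj]
        exact Nat.mul_pos ih (hab _ _).1
  have hdiff : ∀ j n x, e j = some (n, x) → ratVal (s (j + 1)) - ratVal (s j) =
      2 ^ n * ((a (x, n + j + 2) : ℝ) / b (x, n + j + 2)) := by
    intro j n x hj
    have h1 : ((s j).2 : ℝ) ≠ 0 := by exact_mod_cast (hpos j).ne'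
    have h2 : (b (x, n + j + 2) : ℝ) ≠ 0 := by exact_mod_cast (hab _ _).1.ne'
    rw [hs_some j n x hj, ratVal, ratVal]
    push_cast
    field_simp
    ring
  have hlower : ∀ j n x, e j = some (n, x) →
      2 ^ n * P.real (cyl x) < ratVal (s (j + 1)) - ratVal (s j) := by
    intro j n x hj
    rw [hdiff j n x hj]
    exact mul_lt_mul_of_pos_left (hab _ _).2.1 (by positivity)
  have hle_succ : ∀ j, ratVal (s j) ≤ ratVal (s (j + 1)) := by
    intro j
    rcases hj : e j with _ | ⟨n, x⟩
    · rw [hs_none j hj]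
    · have h1 := hlower j n x hj
      have h2 : 0 ≤ 2 ^ n * P.real (cyl x) := by positivity
      linarith
  have hupper : ∀ j, ratVal (s (j + 1)) ≤
      ratVal (s j) + ((weight P (e j)).toReal + (2⁻¹ : ℝ) ^ (j + 2)) := by
    intro j
    rcases hj : e j with _ | ⟨n, x⟩
    · rw [hs_none j hj]
      simp [weight]
    · have h1 := hdiff j n x hj
      have h2 := (mul_lt_mul_of_pos_left (hab x (n + j + 2)).2.2 (by positivity : (0 : ℝ) < 2 ^ n)).le
      have h3 : (2 : ℝ) ^ n * 2⁻¹ ^ (n + j + 2) = 2⁻¹ ^ (j + 2) := by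
        rw [add_assoc, pow_add 2⁻¹ n, ← mul_assoc, ← mul_pow]
        norm_num
      have h4 : (weight P (some (n, x))).toReal = 2 ^ n * P.real (cyl x) := by
        simp [weight, measureReal_def]
      rw [mul_add, h3] at h2
      rw [h4]
      linarith
  have hbound : ∀ j, ratVal (s j) ≤
      ∑ i ∈ Finset.range j, (weight P (e i)).toReal + (2⁻¹ - (2⁻¹ : ℝ) ^ (j + 1)) := by
    intro j
    induction j with
    | zero => simp [s, ratVal]
    | succ j ih =>
      rw [Finset.sum_range_succ]
      have h1 := hupper j
      have h2 : (2⁻¹ : ℝ) ^ (j + 1) = 2⁻¹ ^ (j + 2) + 2⁻¹ ^ (j + 2) := by ring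
      rw [show j + 1 + 1 = j + 2 from rfl]
      linarith
  refine ⟨s, ?_, hpos, monotone_nat_of_le_succ hle_succ, fun j => ?_, hlower⟩
  · exact Computable.nat_rec (f := fun j : ℕ => j) (g := fun _ => ((0, 1) : ℕ × ℕ))
      (h := fun _ z => step z) Computable.id (Computable.const _) (hstep.comp Computable.snd)
  · have hfin : ∀ i, weight P (e i) ≠ ⊤ := fun i =>
      ((ENNReal.le_tsum i).trans hsum).trans_lt (by simp) |>.ne
    have h1 : ∑ i ∈ Finset.range j, (weight P (e i)).toReal ≤ 2⁻¹ := by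
      rw [← ENNReal.toReal_sum fun i _ => hfin i]
      have := ENNReal.toReal_mono (by simp) ((ENNReal.sum_le_tsum (Finset.range j)).trans hsum)
      simpa using this
    have h2 : (0 : ℝ) < 2⁻¹ ^ (j + 1) := by positivity
    have := hbound j
    linarith

theorem exists_machine_of_not_random {P : Measure (Cantor × Cantor)} [IsProbabilityMeasure P]
    (hP : IsComputableProb P) {A : Set (Word × Word)} (hA : REPred fun x => x ∈ A)
    (hA₁ : PartitionCondition₁ A) (hA₂ : PartitionCondition₂ A) {w : Cantor × Cantor}
    (hw : w ∉ randomSet P) (hlub : IsLUB (ofWords '' prefixesIn A w) (ofSeqs w)) :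
    ∃ F f, (REPred fun z => z ∈ F) ∧ MonotoneCondition F ∧ IsDefinedBy F f ∧
      ∀ n, ∃ x ∈ prefixesIn A w, ∃ l : ℕ, Km f (ofWords x) ≤ l ∧
        P (cyl x) ≤ (2⁻¹ : ℝ≥0∞) ^ (n + l) := by
  obtain ⟨U, hU, hwU⟩ : ∃ U, IsTest P U ∧ w ∈ ⋂ n, cover (level U n) := by
    simpa [randomSet] using hw
  rw [Set.mem_iInter] at hwU
  let V : Item → Prop := fun v =>
    v.2 ∈ A ∧ ∃ x, (2 * v.1 + 2, x) ∈ U ∧ ofWords x ≤ ofWords v.2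
  have hV : REPred V := (hA.comp (by fun_prop)).and (rePred_exists
    ((hU.re.comp (by fun_prop)).and (rePred_ofWords_le (by fun_prop) (by fun_prop))))
  obtain ⟨e, he, heV, hapart, hcov⟩ := exists_disjoint_enumeration hA₂ hV (fun v hv => hv.1)
    fun n x y hx hy hxy => ⟨hy, hx.2.imp fun z hz => ⟨hz.1, hz.2.trans hxy⟩⟩
  have hsmall : ∀ n, P (cover {x | ∃ j, e j = some (n, x)}) ≤ (2⁻¹ : ℝ≥0∞) ^ (2 * n + 2) := by
    intro n
    refine (measure_mono fun v hv => ?_).trans (hU.small (2 * n + 2)).le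
    obtain ⟨x, ⟨j, hj⟩, hxv⟩ := mem_cover.1 hv
    obtain ⟨-, y, hy, hyx⟩ := heV j _ hj
    exact mem_cover.2 ⟨y, hy, hyx.trans hxv⟩
  obtain ⟨s, hsc, hs, hmono, hle, hlower⟩ := exists_intervals hP he (tsum_weight_le hapart hsmall)
  obtain ⟨F, f, hF, hFM, hf, hKm⟩ := exists_machine he hsc hs hmono hle
  refine ⟨F, f, hF, hFM, hf, fun n => ?_⟩
  -- Index `n + 2` is used because the dyadic codes lose a factor `4`.
  obtain ⟨x, hx, hxw⟩ := mem_cover.1 (hwU (2 * (n + 2) + 2))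
  obtain ⟨y, hy, hxy⟩ := exists_mem_prefixesIn_ge hA₁ hlub hxw
  -- The prefix `y` itself need not be enumerated, but its cylinder is covered, and the enumerated
  -- `z` whose cylinder contains `w` serves instead.
  obtain ⟨z, ⟨j, hj⟩, hzw⟩ := mem_cover.1 (hcov (n + 2, y) ⟨hy.1, x, hx, hxy⟩ hy.2)
  have hlt := hlower j _ _ hj
  have hnonneg : 0 ≤ 2 ^ (n + 2) * P.real (cyl z) := by positivity
  obtain ⟨l, hl, hle⟩ := hKm j _ _ hj (by linarith)
  refine ⟨z, ⟨(heV j _ hj).1, hzw⟩, l, hl, (measure_lt_two_pow_iff.2 ?_).le⟩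
  have h1 : 2 ^ n * P.real (cyl z) < (2⁻¹ : ℝ) ^ l := by
    rw [pow_add] at hlt
    linarith
  rw [pow_add, inv_pow 2 n, inv_mul_eq_div, lt_div_iff₀ (by positivity), mul_comm]
  exact h1

/-! ### Deficiencies as extended real numbers -/

theorem log2_mono {a b : ℝ≥0∞} (h : a ≤ b) : log2 a ≤ log2 b :=
  EReal.div_le_div_right_of_nonneg (by exact_mod_cast (Real.log_pos one_lt_two).le)
    (ENNReal.log_le_log h)

theorem log2_two_inv_pow (k : ℕ) : log2 ((2⁻¹ : ℝ≥0∞) ^ k) = ((-(k : ℝ) : ℝ) : EReal) := by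
  have h2 : ENNReal.log 2 = ((Real.log 2 : ℝ) : EReal) := by
    rw [ENNReal.log_pos_real (by simp) (by simp)]
    simp
  have hne : Real.log 2 ≠ 0 := (Real.log_pos one_lt_two).ne'
  rw [log2, ENNReal.log_pow, ENNReal.log_inv, h2, ← EReal.coe_neg, ← EReal.coe_coe_eq_natCast,
    ← EReal.coe_mul, ← EReal.coe_div]
  congr 1
  field_simp

theorem ereal_natCast (l : ℕ) : (((l : ℕ∞) : ℝ≥0∞) : EReal) = ((l : ℝ) : EReal) := by
  rw [ENat.toENNReal_coe, EReal.coe_coe_eq_natCast]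
  rfl

theorem deficiency_le {a : ℝ≥0∞} {n l : ℕ} (h : (2⁻¹ : ℝ≥0∞) ^ (n + l) ≤ a) :
    -log2 a - (((l : ℕ∞) : ℝ≥0∞) : EReal) ≤ ((n : ℝ) : EReal) := by
  have h1 := log2_mono h
  rw [log2_two_inv_pow] at h1
  have h2 : -log2 a ≤ ((n + l : ℝ) : EReal) := by
    rw [EReal.neg_le]
    refine le_trans (le_of_eq ?_) h1
    rw [← EReal.coe_neg]
    push_cast
    rfl
  rw [ereal_natCast]
  calc _ ≤ ((n + l : ℝ) : EReal) - ((l : ℝ) : EReal) := EReal.sub_le_sub h2 le_rfl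
    _ = _ := by rw [← EReal.coe_sub]; simp

theorem le_deficiency {a : ℝ≥0∞} {n l : ℕ} {K : ℕ∞} (h : a ≤ (2⁻¹ : ℝ≥0∞) ^ (n + l))
    (hK : K ≤ l) : ((n : ℝ) : EReal) ≤ -log2 a - ((K : ℝ≥0∞) : EReal) := by
  have h1 := log2_mono h
  rw [log2_two_inv_pow] at h1
  have h2 : ((n + l : ℝ) : EReal) ≤ -log2 a := by
    rw [EReal.le_neg]
    refine h1.trans (le_of_eq ?_)
    rw [← EReal.coe_neg]
    push_cast
    rfl
  have h3 : ((K : ℝ≥0∞) : EReal) ≤ ((l : ℝ) : EReal) := by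
    rw [← ereal_natCast]
    exact_mod_cast hK
  calc _ = ((n + l : ℝ) : EReal) - ((l : ℝ) : EReal) := by rw [← EReal.coe_sub]; simp
    _ ≤ _ := EReal.sub_le_sub h2 h3

theorem supDeficiency_anti {P : Measure (Cantor × Cantor)} {A : Set (Word × Word)}
    {K K' : Str × Str → ℕ∞} (h : ∀ x, K x ≤ K' x) (w : Cantor × Cantor) :
    supDeficiency P A K' w ≤ supDeficiency P A K w := by
  refine iSup₂_mono fun x _ => EReal.sub_le_sub le_rfl ?_
  exact_mod_cast h (ofWords x)

theorem Km2_le_Km (f : Str × Str → Str × Str) (x : Str × Str) : Km2 f x ≤ Km f x :=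
  le_iInf₂ fun p hp => (iInf₂_le (p, Str.word []) hp).trans (by simp [Str.length])

theorem exists_word_of_length_le {z : Str} {l : ℕ} (h : z.length ≤ l) :
    ∃ s : Word, z = Str.word s ∧ s.length ≤ l := by
  cases z with
  | word s => exact ⟨s, rfl, by simpa [Str.length] using h⟩
  | seq w => simp [Str.length] at h

/-- A finite bound on the infimum is met by an actual program, and infinite components are excluded
because their length is `⊤`. -/
theorem exists_program_of_Km2_le {u : Str × Str → Str × Str} {x : Str × Str} {l : ℕ}
    (h : Km2 u x ≤ l) : ∃ p : Word × Word, x ≤ u (ofWords p) ∧ p.1.length + p.2.length ≤ l := by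
  have h' : Km2 u x < ((l + 1 : ℕ) : ℕ∞) := h.trans_lt (by exact_mod_cast Nat.lt_succ_self l)
  obtain ⟨p, h'⟩ := iInf_lt_iff.1 h'
  obtain ⟨hp, hlt⟩ := iInf_lt_iff.1 h'
  have hle : p.1.length + p.2.length ≤ (l : ℕ∞) := by
    push_cast at hlt
    exact Order.le_of_lt_add_one hlt
  obtain ⟨s, hs, -⟩ := exists_word_of_length_le (le_self_add.trans hle)
  obtain ⟨t, ht, -⟩ := exists_word_of_length_le (le_add_self.trans hle)
  refine ⟨(s, t), ?_, ?_⟩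
  · rw [ofWords, ← hs, ← ht]
    exact hp
  · rw [hs, ht] at hle
    simp only [Str.length] at hle
    exact_mod_cast hle

theorem exists_program_of_Km_le {u : Str × Str → Str × Str} {x : Str × Str} {l : ℕ}
    (h : Km u x ≤ l) : ∃ p : Word, x ≤ u (ofWords (p, [])) ∧ p.length ≤ l := by
  have h' : Km u x < ((l + 1 : ℕ) : ℕ∞) := h.trans_lt (by exact_mod_cast Nat.lt_succ_self l)
  obtain ⟨p, h'⟩ := iInf_lt_iff.1 h'
  obtain ⟨hp, hlt⟩ := iInf_lt_iff.1 h'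
  have hle : p.length ≤ (l : ℕ∞) := by
    push_cast at hlt
    exact Order.le_of_lt_add_one hlt
  obtain ⟨s, rfl, hs⟩ := exists_word_of_length_le hle
  exact ⟨s, hp, hs⟩

theorem supDeficiency_lt_top {P : Measure (Cantor × Cantor)} [IsProbabilityMeasure P]
    (hP : IsComputableProb P) {A : Set (Word × Word)} (hA : REPred fun x => x ∈ A)
    (hA₁ : PartitionCondition₁ A) {F : Set ((Word × Word) × (Word × Word))}
    (hF : REPred fun z => z ∈ F) {u : Str × Str → Str × Str} (hu : IsDefinedBy F u)
    {w : Cantor × Cantor} (hw : w ∈ randomSet P) : supDeficiency P A (Km2 u) w < ⊤ := by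
  obtain ⟨n, hn⟩ := exists_bound_of_random hP hA hA₁ hF hu hw
  refine lt_of_le_of_lt (b := ((n : ℝ) : EReal)) (iSup₂_le fun x hx => ?_) (EReal.coe_lt_top _)
  cases hK : Km2 u (ofWords x) with
  -- Infinite complexity contributes `⊥`, even for `P (cyl x) = 0`, since `⊤ - ⊤ = ⊥` in `EReal`.
  | top => simp
  | coe l =>
    obtain ⟨p, hp, hpl⟩ := exists_program_of_Km2_le hK.le
    refine deficiency_le (le_trans ?_ (hn x hx p hp))
    exact pow_le_pow_right_of_le_one' (by simp) (by omega)

theorem supDeficiency_eq_top {P : Measure (Cantor × Cantor)} {A : Set (Word × Word)}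
    {w : Cantor × Cantor} {f : Str × Str → Str × Str}
    (hf : ∀ n, ∃ x ∈ prefixesIn A w, ∃ l : ℕ, Km f (ofWords x) ≤ l ∧
      P (cyl x) ≤ (2⁻¹ : ℝ≥0∞) ^ (n + l))
    {K : Str × Str → ℕ∞} {c : ℕ} (hK : ∀ x, K x ≤ Km f x + c) : supDeficiency P A K w = ⊤ := by
  refine EReal.eq_top_iff_forall_lt _ |>.2 fun y => ?_
  obtain ⟨n, hn⟩ := exists_nat_gt y
  -- Taking `n + c` instead of `n` absorbs the additive constant.
  obtain ⟨x, hx, l, hl, hPl⟩ := hf (n + c)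
  refine lt_of_lt_of_le (EReal.coe_lt_coe_iff.2 hn) ?_
  refine le_trans ?_ (le_iSup₂ (f := fun x (_ : x ∈ prefixesIn A w) =>
    -log2 (P (cyl x)) - ((K (ofWords x) : ℝ≥0∞) : EReal)) x hx)
  refine le_deficiency (l := c + l) (by rwa [← add_assoc]) ((hK _).trans ?_)
  rw [add_comm]
  push_cast
  gcongr

/-! ### Universal and optimal functions -/

@[fun_prop]
theorem computable_replicate {α β : Type} [Primcodable α] [Primcodable β] {f : α → ℕ} (b : β)
    (hf : Computable f) : Computable fun a => List.replicate (f a) b := by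
  have h : Primrec fun n : ℕ => (List.range n).map fun _ => b :=
    Primrec.list_map Primrec.list_range (Primrec.const b).to₂
  exact (h.to_comp.comp hf).of_eq fun a => by simp

theorem rePred_universalRel {E : Set (ℕ × (Word × Word) × (Word × Word))}
    (hE : REPred fun z => z ∈ E) : REPred fun z => z ∈ universalRel E := by
  refine (rePred_exists (p := fun (z : (Word × Word) × (Word × Word))
    (y : ℕ × (Word × Word) × (Word × Word)) => y ∈ E ∧
      z = ((List.replicate y.1 false ++ ([true] ++ y.2.1.1), y.2.1.2), y.2.2)) ?_).of_eq
    fun z => ?_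
  · exact (hE.comp (by fun_prop)).and (rePred_eq (by fun_prop) (by fun_prop))
  · simp [universalRel]

/-- Prefixing a program with `0^i 1` costs `i + 1` bits and leaves the second component empty, so
the bound holds for `Km` and not only for `Km2`. -/
theorem Km_universal_le {E : Set (ℕ × (Word × Word) × (Word × Word))}
    {u f : Str × Str → Str × Str} (hu : IsDefinedBy (universalRel E) u) {i : ℕ}
    (hf : IsDefinedBy (slice E i) f) (x : Str × Str) : Km u x ≤ Km f x + ((i + 1 : ℕ) : ℕ∞) := by
  cases hK : Km f x with
  | top => simp
  | coe l =>
    obtain ⟨p, hp, hpl⟩ := exists_program_of_Km_le hK.le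
    refine (iInf₂_le (Str.word (List.replicate i false ++ true :: p)) ?_).trans ?_
    · refine hp.trans ((hf _).2 ?_)
      rintro _ ⟨q, y, hy, hq, rfl⟩
      refine (hu _).1 ⟨(List.replicate i false ++ true :: q.1, q.2), y, ⟨i, q.1, q.2, y, hy, rfl⟩,
        ⟨?_, hq.2⟩, rfl⟩
      exact (List.prefix_append_right_inj _).2 (List.cons_prefix_cons.2 ⟨rfl, hq.1⟩)
    · simp only [Str.length, List.length_append, List.length_replicate, List.length_cons]
      exact_mod_cast (by omega : i + (p.length + 1) ≤ l + (i + 1))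

end KmProd

theorem mainTheorem2 (P : Measure (Cantor × Cantor)) [IsProbabilityMeasure P]
    (hP : IsComputableProb P)
    (A : Set (Word × Word)) (hA : REPred fun x => x ∈ A)
    (hA₁ : PartitionCondition₁ A) (hA₂ : PartitionCondition₂ A) :
    (∀ u : Str × Str → Str × Str, IsUniversalMonotone u → ∀ w : Cantor × Cantor,
      (w ∈ randomSet P → supDeficiency P A (Km u) w < ⊤) ∧
      (supDeficiency P A (Km u) w < ⊤ → IsLUB (ofWords '' prefixesIn A w) (ofSeqs w) →
        w ∈ randomSet P) ∧
      (w ∈ randomSet P → supDeficiency P A (Km2 u) w < ⊤) ∧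
      (supDeficiency P A (Km2 u) w < ⊤ → IsLUB (ofWords '' prefixesIn A w) (ofSeqs w) →
        w ∈ randomSet P)) ∧
    (∀ u : Str × Str → Str × Str, IsOptimal u → ∀ w : Cantor × Cantor,
      (w ∈ randomSet P → supDeficiency P A (Km2 u) w < ⊤) ∧
      (supDeficiency P A (Km2 u) w < ⊤ → IsLUB (ofWords '' prefixesIn A w) (ofSeqs w) →
        w ∈ randomSet P)) := by
  constructor
  · rintro u ⟨E, hE, hu⟩ w
    have h1 : w ∈ randomSet P → supDeficiency P A (Km2 u) w < ⊤ :=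
      supDeficiency_lt_top hP hA hA₁ (rePred_universalRel hE.re) hu
    have h2 : supDeficiency P A (Km u) w < ⊤ → IsLUB (ofWords '' prefixesIn A w) (ofSeqs w) →
        w ∈ randomSet P := by
      intro hlt hlub
      by_contra hw
      obtain ⟨F, f, hF, hFM, hf, hn⟩ := exists_machine_of_not_random hP hA hA₁ hA₂ hw hlub
      obtain ⟨i, rfl⟩ := hE.exhaust F hF hFM
      exact hlt.ne (supDeficiency_eq_top hn fun x => Km_universal_le hu hf x)
    have h3 : supDeficiency P A (Km u) w ≤ supDeficiency P A (Km2 u) w :=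
      supDeficiency_anti (Km2_le_Km u) w
    exact ⟨fun hw => h3.trans_lt (h1 hw), h2, h1, fun hlt => h2 (h3.trans_lt hlt)⟩
  · rintro u ⟨⟨F, hF, -, hu⟩, hopt⟩ w
    refine ⟨supDeficiency_lt_top hP hA hA₁ hF hu, fun hlt hlub => ?_⟩
    by_contra hw
    obtain ⟨F', f, hF', hFM, hf, hn⟩ := exists_machine_of_not_random hP hA hA₁ hA₂ hw hlub
    obtain ⟨c, hc⟩ := hopt f ⟨F', hF', hFM, hf⟩
    refine hlt.ne (supDeficiency_eq_top (c := c) hn fun x => (hc x).trans ?_)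
    -- Optimality only concerns `Km2`; it applies because the constructed machine has short programs
    -- with empty second component.
    gcongr
    exact Km2_le_Km f x
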